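/- Let $D\subseteq\mathbb{C}^n$ be a domain containing the origin $o$, $\psi$ a plurisubharmonic function on $D$, $\mathcal{O}_o$ the ring of germs of holomorphic functions at $o$, $F\in\mathcal{O}_o$, and $I\subsetneq\mathcal{O}_o$ a proper ideal which does not contain the multiplier ideal $\mathcal{I}(\psi)_o=\{G\in\mathcal{O}_o : |G|^2e^{-\psi}\text{ is integrable near } o\}$. Let $\ell_1^{(n)}$ be the set of families $\xi=(\xi_\alpha)_{\alpha\in\mathbb{N}^n}$ of complex numbers with $\sum_\alpha|\xi_\alpha|\rho^{|\alpha|}<\infty$ for all $\rho>0$, and $\ell_0^{(n)}\subseteq\ell_1^{(n)}$ the set of those with only finitely many nonzero terms. For $\xi\in\ell_1^{(n)}$ and $f$ holomorphic near $o$ put $(\xi\cdot f)(o)=\sum_\alpha\xi_\alpha\frac{(D^\alpha f)(o)}{\alpha!}$, and let $\ell_I$ be the set of all $\xi\in\ell_1^{(n)}\setminus\{0\}$ with $(\xi\cdot f)(o)=0$ for every $f\in I$. Let $\|f\|_{D,\psi}^2=\int_D|f|^2e^{-\psi}$, let $A^2_\psi(D)$ be the space of holomorphic functions $f$ on $D$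 with $\|f\|_{D,\psi}<\infty$, and let $$K^\psi_{\xi,D}(o)=\sup\{|(\xi\cdot f)(o)|^2 : f\in A^2_\psi(D),\ \|f\|_{D,\psi}\le 1\}.$$ Define $$B_\psi(F,I,D)=\sup_{\xi\in\ell_I}\frac{|(\xi\cdot F)(o)|^2}{K^\psi_{\xi,D}(o)},\qquad B^\circ_\psi(F,I,D)=\sup_{\xi\in\ell_I\cap\ell_0^{(n)}}\frac{|(\xi\cdot F)(o)|^2}{K^\psi_{\xi,D}(o)},$$ $$C_{F,\psi,I}(D)=\inf\{\|\tilde F\|_{D,\psi}^2 : \tilde F\in A^2_\psi(D),\ (\tilde F-F,o)\in I\},$$ as elements of $[0,+\infty]$, with the conventions $c/0=+\infty$ for $c>0$, $0/0=0$ and $\inf\emptyset=+\infty$. Then $$B^\circ_\psi(F,I,D)=B_\psi(F,I,D)=C_{F,\psi,I}(D).$$ -/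

import Mathlib

open Filter Topology MeasureTheory Set
open scoped ENNReal

noncomputable section

/-! Points of `ℂⁿ` are functions `Fin n → ℂ`; `volume` is Lebesgue measure on `ℂⁿ`; the origin is
`0`. Multi-indices are functions `Fin n → ℕ`, and the length of `α` is `∑ i, α i`. -/

/-- The ring `𝒪_o` of germs at the origin of holomorphic functions on `ℂⁿ`, as a subring of the
ring of germs of all functions. -/
def HolGerm (n : ℕ) : Subring (Germ (𝓝 (0 : Fin n → ℂ)) ℂ) where
  carrier := {g | ∃ f : (Fin n → ℂ) → ℂ, AnalyticAt ℂ f 0 ∧ (f : Germ (𝓝 (0 : Fin n → ℂ)) ℂ) = g}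
  mul_mem' := by
    rintro _ _ ⟨f, hf, rfl⟩ ⟨g, hg, rfl⟩
    exact ⟨f * g, hf.mul hg, rfl⟩
  one_mem' := ⟨1, analyticAt_const, rfl⟩
  add_mem' := by
    rintro _ _ ⟨f, hf, rfl⟩ ⟨g, hg, rfl⟩
    exact ⟨f + g, hf.add hg, rfl⟩
  zero_mem' := ⟨0, analyticAt_const, rfl⟩
  neg_mem' := by
    rintro _ ⟨f, hf, rfl⟩
    exact ⟨-f, hf.neg, rfl⟩

/-- The mixed partial derivative `D^α f (z)`: the `|α|`-th complex derivative of `f` at `z`,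
applied to `α 0` copies of the first standard basis vector, `α 1` copies of the second one, etc. -/
def partialDeriv {n : ℕ} (α : Fin n → ℕ) (f : (Fin n → ℂ) → ℂ) (z : Fin n → ℂ) : ℂ :=
  iteratedFDeriv ℂ (∑ i, α i) f z
    (fun j => Pi.single (finSigmaFinEquiv.symm j : (i : Fin n) × Fin (α i)).1 1)

/-- The pairing `(ξ · f)(z) = ∑_α ξ_α (D^α f)(z) / α!`. -/
def pairing {n : ℕ} (ξ : (Fin n → ℕ) → ℂ) (f : (Fin n → ℂ) → ℂ) (z : Fin n → ℂ) : ℂ :=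
  ∑' α : Fin n → ℕ, ξ α * (partialDeriv α f z / ((∏ i, (α i).factorial : ℕ) : ℂ))

/-- The pairing at the origin depends only on the germ. -/
theorem pairing_congr {n : ℕ} (ξ : (Fin n → ℕ) → ℂ) {f g : (Fin n → ℂ) → ℂ}
    (h : f =ᶠ[𝓝 0] g) : pairing ξ f 0 = pairing ξ g 0 := by
  unfold pairing partialDeriv
  refine tsum_congr fun α => ?_
  rw [(h.iteratedFDeriv ℂ (∑ i, α i)).eq_of_nhds]

/-- The pairing `(ξ · F)(o)` with a germ `F` of a holomorphic function. -/
def germPairing {n : ℕ} (ξ : (Fin n → ℕ) → ℂ) (F : HolGerm n) : ℂ :=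
  Germ.liftOn (F : Germ (𝓝 (0 : Fin n → ℂ)) ℂ) (fun f => pairing ξ f 0)
    (fun _ _ h => pairing_congr ξ h)

/-- `ℓ₁⁽ⁿ⁾`: families `ξ` with `∑_α |ξ_α| ρ^|α| < ∞` for every `ρ > 0`. -/
def ell1 (n : ℕ) : Set ((Fin n → ℕ) → ℂ) :=
  {ξ | ∀ ρ : ℝ, 0 < ρ → Summable fun α : Fin n → ℕ => ‖ξ α‖ * ρ ^ (∑ i, α i)}

/-- `ℓ₀⁽ⁿ⁾`: families `ξ` with `ξ_α = 0` for all `α` of sufficiently large length. -/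
def ell0 (n : ℕ) : Set ((Fin n → ℕ) → ℂ) :=
  {ξ | ∃ k : ℕ, ∀ α : Fin n → ℕ, k < ∑ i, α i → ξ α = 0}

/-- `ℓ_I`: the nonzero `ξ ∈ ℓ₁⁽ⁿ⁾` with `(ξ · f)(o) = 0` for all `f ∈ I`. -/
def ellIdeal {n : ℕ} (I : Ideal (HolGerm n)) : Set ((Fin n → ℕ) → ℂ) :=
  {ξ | ξ ∈ ell1 n ∧ (∀ f ∈ I, germPairing ξ f = 0) ∧ ξ ≠ 0}

/-- `ψ` is plurisubharmonic on the open set `D`: it takes values in `[-∞, ∞)`, is upper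
semicontinuous, and satisfies the sub-mean value inequality
`ψ z ≤ (1 / 2π) ∫₀^{2π} ψ (z + e^{iθ} w) dθ` whenever the closed disc `{z + ζ w : |ζ| ≤ 1}` lies
in `D`. As `ψ` may take the value `-∞`, the inequality is written for the nonnegative function
`M - ψ`, where `M` is any real upper bound of `ψ` on the boundary circle. -/
structure IsPSH {n : ℕ} (ψ : (Fin n → ℂ) → EReal) (D : Set (Fin n → ℂ)) : Prop where
  ne_top : ∀ z ∈ D, ψ z ≠ ⊤
  usc : UpperSemicontinuousOn ψ D
  submean : ∀ z w : Fin n → ℂ, (∀ ζ : ℂ, ‖ζ‖ ≤ 1 → z + ζ • w ∈ D) →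
    ∀ M : ℝ, (∀ θ : ℝ, ψ (z + Complex.exp (θ * Complex.I) • w) ≤ (M : EReal)) →
      ∫⁻ θ in Ioc 0 (2 * Real.pi),
          ((M : EReal) - ψ (z + Complex.exp (θ * Complex.I) • w)).toENNReal
        ≤ ENNReal.ofReal (2 * Real.pi) * ((M : EReal) - ψ z).toENNReal

/-- The squared weighted norm `‖f‖²_{D,ψ} = ∫_D |f|² e^{-ψ}`, with values in `[0, ∞]`. -/
def weightedNormSq {n : ℕ} (D : Set (Fin n → ℂ)) (ψ : (Fin n → ℂ) → EReal)
    (f : (Fin n → ℂ) → ℂ) : ℝ≥0∞ :=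
  ∫⁻ z in D, ‖f z‖ₑ ^ 2 * EReal.exp (-ψ z)

/-- The weighted Bergman space `A²_ψ(D)`: functions holomorphic on the open set `D`, with
`∫_D |f|² e^{-ψ} < ∞`. (Elements are represented by functions on `ℂⁿ`; values outside `D` play
no role.) -/
def weightedBergman {n : ℕ} (D : Set (Fin n → ℂ)) (ψ : (Fin n → ℂ) → EReal) :
    Set ((Fin n → ℂ) → ℂ) :=
  {f | AnalyticOnNhd ℂ f D ∧ weightedNormSq D ψ f < ⊤}

/-- The multiplier ideal `ℐ(ψ)_o`: germs `G` such that `|G|² e^{-ψ}` is integrable near `o`. -/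
def multiplierIdeal {n : ℕ} (ψ : (Fin n → ℂ) → EReal) : Set (HolGerm n) :=
  {G | ∃ g : (Fin n → ℂ) → ℂ, (g : Germ (𝓝 (0 : Fin n → ℂ)) ℂ) = G ∧
    ∃ U ∈ 𝓝 (0 : Fin n → ℂ), weightedNormSq U ψ g < ⊤}

/-- The weighted Bergman kernel `K^ψ_{ξ,D}(z)` with respect to `ξ`, with values in `[0, ∞]`. -/
def weightedKernel {n : ℕ} (ξ : (Fin n → ℕ) → ℂ) (D : Set (Fin n → ℂ))
    (ψ : (Fin n → ℂ) → EReal) (z : Fin n → ℂ) : ℝ≥0∞ :=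
  ⨆ f ∈ {f | f ∈ weightedBergman D ψ ∧ weightedNormSq D ψ f ≤ 1}, ‖pairing ξ f z‖ₑ ^ 2

/-- `B_ψ(F, I, D)`. In `[0, ∞]` one has `c / 0 = ∞` for `c ≠ 0` and `0 / 0 = 0`. -/
def Bweighted {n : ℕ} (ψ : (Fin n → ℂ) → EReal) (F : HolGerm n) (I : Ideal (HolGerm n))
    (D : Set (Fin n → ℂ)) : ℝ≥0∞ :=
  ⨆ ξ ∈ ellIdeal I, ‖germPairing ξ F‖ₑ ^ 2 / weightedKernel ξ D ψ 0

/-- `B°_ψ(F, I, D)`: the same supremum, restricted to `ξ ∈ ℓ_I ∩ ℓ₀⁽ⁿ⁾`. -/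
def BweightedCirc {n : ℕ} (ψ : (Fin n → ℂ) → EReal) (F : HolGerm n) (I : Ideal (HolGerm n))
    (D : Set (Fin n → ℂ)) : ℝ≥0∞ :=
  ⨆ ξ ∈ ellIdeal I ∩ ell0 n, ‖germPairing ξ F‖ₑ ^ 2 / weightedKernel ξ D ψ 0

/-- The minimal weighted `L²` integral `C_{F,ψ,I}(D)`: the infimum of `‖f‖²_{D,ψ}` over the
`f ∈ A²_ψ(D)` whose germ `G` at `o` satisfies `G - F ∈ I`; it is `∞` if there is no such `f`. -/
def minimalIntegral {n : ℕ} (F : HolGerm n) (ψ : (Fin n → ℂ) → EReal) (I : Ideal (HolGerm n))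
    (D : Set (Fin n → ℂ)) : ℝ≥0∞ :=
  ⨅ f ∈ {f | f ∈ weightedBergman D ψ ∧
      ∃ G : HolGerm n, (f : Germ (𝓝 (0 : Fin n → ℂ)) ℂ) = G ∧ G - F ∈ I},
    weightedNormSq D ψ f

end

/-! The inequality `B° ≤ B` is a comparison of index sets. For `B ≤ C`, a competitor `f` for `C`
satisfies `ξ · f = ξ · F` for every `ξ` annihilating `I`, and homogeneity bounds `|ξ · f|²` by
`‖f‖²` times the kernel.

The inequality `C ≤ B°` is Hilbert space duality. If `B° = b` is finite, then on the finitely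
supported annihilators of `I` the form `ξ ↦ ξ · F` is bounded by `√b` times the norm of `f ↦ ξ · f`
on the weighted Bergman space. Hahn-Banach and reflexivity (`exists_norm_le_of_functional_bound`)
give one `f` with `‖f‖² ≤ b` and `ξ · f = ξ · F` for all these `ξ`. This needs a complete Bergman
space with continuous Taylor coefficients. Both follow from `exists_local_bound`: the mean value
inequality, together with local upper bounds for `ψ`, controls sup norms by the weighted norm.

It remains to see that `f - F` lies in `I`. Linear algebra on jets shows that each jet of `f - F` is
the jet of a member of `I`, so what is needed is that ideals are closed in the Krull topology
(`mem_ideal_of_forall_taylor`). This comes from Grauert division (`exists_division`): every germ is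
congruent modulo `I` to one with no term at an initial exponent of `I`. If all jets of the germ come
from `I`, a nonzero remainder would have its lowest exponent among the initial ones, a
contradiction.

Monomials are ordered by `N(α) = ∏ pᵢ ^ αᵢ`. This size is injective and multiplicative and lies
between two geometric functions of the degree, so it serves as monomial order, growth scale and
summability weight at once. -/

/-! ### Multi-indices ordered by products of prime powers -/

/-- The multiplicative size `∏ i, pᵢ ^ αᵢ` of a multi-index, where `pᵢ` is the `i`-th prime. -/
noncomputable def primeSize {n : ℕ} (α : Fin n → ℕ) : ℕ := ∏ i : Fin n, (Nat.nth Nat.Prime i) ^ α i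

theorem primeSize_pos {n : ℕ} (α : Fin n → ℕ) : 0 < primeSize α :=
  Finset.prod_pos fun i _ => pow_pos (Nat.prime_nth_prime i).pos _

theorem primeSize_zero {n : ℕ} : primeSize (0 : Fin n → ℕ) = 1 := by simp [primeSize]

theorem primeSize_add {n : ℕ} (α β : Fin n → ℕ) :
    primeSize (α + β) = primeSize α * primeSize β := by
  simp [primeSize, pow_add, Finset.prod_mul_distrib]

/-- Unique factorization: each exponent is recovered as a prime valuation. Comparing sizes is
therefore a total order on monomials. -/
theorem primeSize_injective {n : ℕ} : Function.Injective (primeSize (n := n)) := by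
  intro α β h
  funext i
  have key : ∀ γ : Fin n → ℕ, (primeSize γ).factorization (Nat.nth Nat.Prime i) = γ i := by
    intro γ
    unfold primeSize
    rw [Nat.factorization_prod fun (j : Fin n) _ =>
      (pow_pos (Nat.prime_nth_prime j).pos (γ j)).ne']
    rw [Finsupp.finsetSum_apply, Finset.sum_eq_single i]
    · simp
    · intro j _ hj
      rw [(Nat.prime_nth_prime j).factorization_pow, Finsupp.single_apply, if_neg]
      intro h
      exact hj (Fin.ext (Nat.nth_injective Nat.infinite_setOfPred_prime h))
    · simp
  rw [← key α, ← key β, h]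

theorem two_pow_le_primeSize {n : ℕ} (α : Fin n → ℕ) : 2 ^ (∑ i, α i) ≤ primeSize α := by
  rw [← Finset.prod_pow_eq_pow_sum]
  exact Finset.prod_le_prod' fun i _ => Nat.pow_le_pow_left (Nat.prime_nth_prime i).two_le _

theorem primeSize_le {n : ℕ} (α : Fin n → ℕ) :
    primeSize α ≤ (Nat.nth Nat.Prime n) ^ (∑ i, α i) := by
  rw [← Finset.prod_pow_eq_pow_sum]
  exact Finset.prod_le_prod' fun i _ =>
    Nat.pow_le_pow_left ((Nat.nth_strictMono Nat.infinite_setOfPred_prime).monotone i.2.le) _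

/-- By injectivity this is a subfamily of `∑ m⁻²`, so two spare powers of the size always buy
absolute convergence. -/
theorem summable_primeSize (n : ℕ) :
    Summable fun α : Fin n → ℕ => ((primeSize α : ℝ) ^ 2)⁻¹ :=
  (Real.summable_nat_pow_inv.2 one_lt_two).comp_injective primeSize_injective

/-! ### Monomials and growth of coefficients -/

/-- The monomial `z ^ α`. -/
def monomialEval {n : ℕ} (z : Fin n → ℂ) (α : Fin n → ℕ) : ℂ := ∏ i, z i ^ α i

theorem monomialEval_add {n : ℕ} (z : Fin n → ℂ) (α β : Fin n → ℕ) :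
    monomialEval z (α + β) = monomialEval z α * monomialEval z β := by
  simp [monomialEval, pow_add, Finset.prod_mul_distrib]

theorem norm_monomialEval_le {n : ℕ} {z : Fin n → ℂ} {r : ℝ} (hz : ‖z‖ ≤ r) (α : Fin n → ℕ) :
    ‖monomialEval z α‖ ≤ r ^ (∑ i, α i) := by
  rw [monomialEval, norm_prod, ← Finset.prod_pow_eq_pow_sum]
  refine Finset.prod_le_prod (fun _ _ => norm_nonneg _) fun i _ => ?_
  rw [norm_pow]
  exact pow_le_pow_left₀ (norm_nonneg _) ((norm_le_pi_norm z i).trans hz) _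

/-- The polyradius on which families bounded by `primeSize ^ s` define bounded monomials. -/
noncomputable def polyradius (n s : ℕ) : ℝ := ((Nat.nth Nat.Prime n : ℝ) ^ s)⁻¹

theorem polyradius_pos (n s : ℕ) : 0 < polyradius n s :=
  inv_pos.2 (pow_pos (Nat.cast_pos.2 (Nat.prime_nth_prime n).pos) _)

theorem polyradius_pow_le {n : ℕ} (s : ℕ) (α : Fin n → ℕ) :
    polyradius n s ^ (∑ i, α i) ≤ ((primeSize α : ℝ) ^ s)⁻¹ := by
  rw [polyradius, inv_pow, ← pow_mul, mul_comm, pow_mul]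
  have := primeSize_pos α
  gcongr
  exact_mod_cast primeSize_le α

theorem norm_monomialEval_le_primeSize {n s : ℕ} {z : Fin n → ℂ} (hz : ‖z‖ ≤ polyradius n s)
    (α : Fin n → ℕ) : ‖monomialEval z α‖ ≤ ((primeSize α : ℝ) ^ s)⁻¹ :=
  (norm_monomialEval_le hz α).trans (polyradius_pow_le s α)

/-- Families of coefficients of at most geometric growth, with explicit exponent. -/
def CoeffBound {n : ℕ} (a : (Fin n → ℕ) → ℂ) (C : ℝ) (s : ℕ) : Prop :=
  ∀ α, ‖a α‖ ≤ C * (primeSize α : ℝ) ^ s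

theorem one_le_primeSize {n : ℕ} (α : Fin n → ℕ) : (1 : ℝ) ≤ primeSize α := by
  exact_mod_cast primeSize_pos α

theorem CoeffBound.nonneg {n : ℕ} {a : (Fin n → ℕ) → ℂ} {C : ℝ} {s : ℕ} (h : CoeffBound a C s) :
    0 ≤ C := by
  have := (norm_nonneg _).trans (h 0)
  simpa [primeSize_zero] using this

theorem CoeffBound.mono {n : ℕ} {a : (Fin n → ℕ) → ℂ} {C C' : ℝ} {s s' : ℕ}
    (h : CoeffBound a C s) (hC : C ≤ C') (hs : s ≤ s') : CoeffBound a C' s' := fun α =>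
  (h α).trans (mul_le_mul hC (pow_le_pow_right₀ (one_le_primeSize α) hs)
    (by positivity) (h.nonneg.trans hC))

theorem CoeffBound.mul_polyradius_le {n : ℕ} {a : (Fin n → ℕ) → ℂ} {C : ℝ} {s : ℕ}
    (h : CoeffBound a C s) (α : Fin n → ℕ) :
    ‖a α‖ * polyradius n (s + 2) ^ (∑ i, α i) ≤ C * ((primeSize α : ℝ) ^ 2)⁻¹ := by
  have h1 := one_le_primeSize α
  calc ‖a α‖ * polyradius n (s + 2) ^ (∑ i, α i)
      ≤ (C * (primeSize α : ℝ) ^ s) * ((primeSize α : ℝ) ^ (s + 2))⁻¹ :=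
        mul_le_mul (h α) (polyradius_pow_le _ α) (pow_nonneg (polyradius_pos _ _).le _)
          (mul_nonneg h.nonneg (by positivity))
    _ = C * ((primeSize α : ℝ) ^ 2)⁻¹ := by
        have : (primeSize α : ℝ) ≠ 0 := by positivity
        rw [pow_add]
        field_simp

theorem CoeffBound.summable_polyradius {n : ℕ} {a : (Fin n → ℕ) → ℂ} {C : ℝ} {s : ℕ}
    (h : CoeffBound a C s) : Summable fun α => ‖a α‖ * polyradius n (s + 2) ^ (∑ i, α i) :=
  Summable.of_nonneg_of_le
    (fun _ => mul_nonneg (norm_nonneg _) (pow_nonneg (polyradius_pos _ _).le _))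
    h.mul_polyradius_le ((summable_primeSize n).mul_left C)

theorem CoeffBound.summable_norm {n : ℕ} {a : (Fin n → ℕ) → ℂ} {C : ℝ} {s : ℕ}
    (h : CoeffBound a C s) {z : Fin n → ℂ} (hz : ‖z‖ ≤ polyradius n (s + 2)) :
    Summable fun α => ‖a α * monomialEval z α‖ :=
  h.summable_polyradius.of_nonneg_of_le (fun _ => norm_nonneg _) fun α => by
    rw [norm_mul]
    exact mul_le_mul_of_nonneg_left (norm_monomialEval_le hz α) (norm_nonneg _)

/-! ### Power series and Taylor coefficients -/

/-- The nondecreasing list of directions of a multi-index of length `k`. -/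
def dirs {n k : ℕ} (α : Fin n → ℕ) (h : ∑ i, α i = k) (j : Fin k) : Fin n :=
  (finSigmaFinEquiv.symm (Fin.cast h.symm j) : (i : Fin n) × Fin (α i)).1

theorem card_dirs {n k : ℕ} (α : Fin n → ℕ) (h : ∑ i, α i = k) (i : Fin n) :
    Fintype.card {j // dirs α h j = i} = α i := by
  subst h
  have e : {j // dirs α rfl j = i} ≃ Fin (α i) :=
    (finSigmaFinEquiv.symm.subtypeEquiv (q := fun x : (i : Fin n) × Fin (α i) => x.1 = i)
      fun j => Iff.rfl).trans (Equiv.sigmaSubtype i)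
  simpa using Fintype.card_congr e

theorem dirs_comp_perm_eq {n k : ℕ} {α β : Fin n → ℕ} (hα : ∑ i, α i = k) (hβ : ∑ i, β i = k)
    (σ : Equiv.Perm (Fin k)) (h : dirs α hα ∘ σ = dirs β hβ) : α = β := by
  funext i
  rw [← card_dirs α hα i, ← card_dirs β hβ i, ← h]
  exact (Fintype.card_congr (σ.subtypeEquiv fun j => Iff.rfl)).symm

theorem prod_dirs {n k : ℕ} (α : Fin n → ℕ) (h : ∑ i, α i = k) (z : Fin n → ℂ) :
    ∏ j, z (dirs α h j) = monomialEval z α := by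
  subst h
  unfold dirs monomialEval
  simp only [Fin.cast_eq_self]
  rw [finSigmaFinEquiv.symm.prod_comp (fun x : (i : Fin n) × Fin (α i) => z x.1)]
  rw [Fintype.prod_sigma]
  simp

/-- The monomial multilinear form `v ↦ ∏ j, (v j)_{σ j}`. -/
noncomputable def dirForm {n k : ℕ} (σ : Fin k → Fin n) :
    ContinuousMultilinearMap ℂ (fun _ : Fin k => Fin n → ℂ) ℂ :=
  (ContinuousMultilinearMap.mkPiAlgebra ℂ (Fin k) ℂ).compContinuousLinearMap
    fun j => ContinuousLinearMap.proj (σ j)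

theorem dirForm_apply {n k : ℕ} (σ : Fin k → Fin n) (v : Fin k → Fin n → ℂ) :
    dirForm σ v = ∏ j, v j (σ j) := by
  simp [dirForm]

theorem norm_dirForm_le {n k : ℕ} (σ : Fin k → Fin n) : ‖dirForm σ‖ ≤ 1 := by
  refine ContinuousMultilinearMap.opNorm_le_bound zero_le_one fun v => ?_
  rw [dirForm_apply, norm_prod, one_mul]
  exact Finset.prod_le_prod (fun _ _ => norm_nonneg _) fun j _ => norm_le_pi_norm _ _

/-- The formal multilinear series of the power series with coefficients `a`. -/
noncomputable def coeffSeries {n : ℕ} (a : (Fin n → ℕ) → ℂ) :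
    FormalMultilinearSeries ℂ (Fin n → ℂ) ℂ := fun k =>
  ∑ x : {α // α ∈ Finset.piAntidiag (Finset.univ : Finset (Fin n)) k},
    a x.1 • dirForm (dirs x.1 (Finset.mem_piAntidiag.1 x.2).1)

theorem coeffSeries_apply_diag {n : ℕ} (a : (Fin n → ℕ) → ℂ) (k : ℕ) (z : Fin n → ℂ) :
    coeffSeries a k (fun _ => z)
      = ∑ α ∈ Finset.piAntidiag Finset.univ k, a α * monomialEval z α := by
  rw [coeffSeries, sum_apply,
    ← Finset.sum_coe_sort _ fun α => a α * monomialEval z α]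
  refine Finset.sum_congr rfl fun x _ => ?_
  simp [dirForm_apply, prod_dirs]

theorem norm_coeffSeries_le {n : ℕ} (a : (Fin n → ℕ) → ℂ) (k : ℕ) :
    ‖coeffSeries a k‖ ≤ ∑ α ∈ Finset.piAntidiag Finset.univ k, ‖a α‖ := by
  rw [coeffSeries, ← Finset.sum_coe_sort _ fun α => ‖a α‖]
  refine norm_sum_le_of_le _ fun x _ => ?_
  rw [norm_smul]
  exact mul_le_of_le_one_right (norm_nonneg _) (norm_dirForm_le _)

theorem hasSum_degree {n : ℕ} {E : Type*} [NormedAddCommGroup E] [CompleteSpace E]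
    {u : (Fin n → ℕ) → E} (hu : Summable u) :
    HasSum (fun k => ∑ α ∈ Finset.piAntidiag Finset.univ k, u α) (∑' α, u α) := by
  have h1 : HasSum (u ∘ Equiv.sigmaFiberEquiv fun α : Fin n → ℕ => ∑ i, α i) (∑' α, u α) :=
    (Equiv.hasSum_iff _).2 hu.hasSum
  refine (h1.sigma fun k => ?_)
  have h2 := (Finset.piAntidiag (Finset.univ : Finset (Fin n)) k).hasSum u
  convert! (Equiv.hasSum_iff (Equiv.subtypeEquivRight fun α : Fin n → ℕ =>
    (by simp : ∑ i, α i = k ↔ α ∈ Finset.piAntidiag (Finset.univ : Finset (Fin n)) k))).2 h2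

theorem CoeffBound.hasFPowerSeriesOnBall {n : ℕ} {a : (Fin n → ℕ) → ℂ} {C : ℝ} {s : ℕ}
    (h : CoeffBound a C s) :
    HasFPowerSeriesOnBall (fun z => ∑' α, a α * monomialEval z α) (coeffSeries a) 0
      (ENNReal.ofReal (polyradius n (s + 2))) where
  r_le := by
    refine FormalMultilinearSeries.le_radius_of_summable_norm _ ?_
    have h2 := (hasSum_degree h.summable_polyradius).summable
    refine h2.of_nonneg_of_le (fun k => by positivity) fun k => ?_
    rw [Real.coe_toNNReal _ (polyradius_pos _ _).le]
    refine (mul_le_mul_of_nonneg_right (norm_coeffSeries_le a k)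
      (pow_nonneg (polyradius_pos _ _).le _)).trans ?_
    rw [Finset.sum_mul]
    refine Finset.sum_le_sum fun α hα => ?_
    rw [(Finset.mem_piAntidiag.1 hα).1]
  r_pos := ENNReal.ofReal_pos.2 (polyradius_pos _ _)
  hasSum := by
    intro z hz
    have hz' : ‖z‖ ≤ polyradius n (s + 2) := by
      have : edist z 0 < ENNReal.ofReal (polyradius n (s + 2)) := hz
      rw [edist_dist, ENNReal.ofReal_lt_ofReal_iff (polyradius_pos _ _), dist_zero_right] at this
      exact this.le
    simp only [coeffSeries_apply_diag, zero_add]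
    exact hasSum_degree (h.summable_norm hz').of_norm

/-- The Taylor coefficient `(D^α f)(0) / α!`. -/
noncomputable def taylorCoeff {n : ℕ} (f : (Fin n → ℂ) → ℂ) (α : Fin n → ℕ) : ℂ :=
  partialDeriv α f 0 / ((∏ i, (α i).factorial : ℕ) : ℂ)

theorem partialDeriv_eq_dirs {n : ℕ} (α : Fin n → ℕ) (f : (Fin n → ℂ) → ℂ) (z : Fin n → ℂ) :
    partialDeriv α f z =
      iteratedFDeriv ℂ (∑ i, α i) f z (fun j => Pi.single (dirs α rfl j) 1) := rfl

/-- The iterated derivative is the sum of the degree `|α|` term over all permutations of the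
directions. Only permutations fixing the direction list contribute, each giving `a α`, and this
stabilizer has `α!` elements, which cancels the denominator. -/
theorem taylorCoeff_of_hasFPowerSeriesOnBall {n : ℕ} {f : (Fin n → ℂ) → ℂ}
    {a : (Fin n → ℕ) → ℂ} {r : ℝ≥0∞} (h : HasFPowerSeriesOnBall f (coeffSeries a) 0 r)
    (α : Fin n → ℕ) : taylorCoeff f α = a α := by
  have hfac : ((∏ i, (α i).factorial : ℕ) : ℂ) ≠ 0 :=
    Nat.cast_ne_zero.2 (Finset.prod_pos fun i _ => Nat.factorial_pos _).ne'
  rw [taylorCoeff, div_eq_iff hfac, partialDeriv_eq_dirs,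
    h.iteratedFDeriv_eq_sum_of_completeSpace]
  have key : ∀ σ : Equiv.Perm (Fin (∑ i, α i)),
      coeffSeries a (∑ i, α i) (fun j => Pi.single (dirs α rfl (σ j)) (1 : ℂ))
        = if dirs α rfl ∘ σ = dirs α rfl then a α else 0 := by
    intro σ
    rw [coeffSeries, sum_apply]
    have hterm : ∀ (β : Fin n → ℕ) (hβ : ∑ i, β i = ∑ i, α i),
        (a β • dirForm (dirs β hβ)) (fun j => Pi.single (dirs α rfl (σ j)) (1 : ℂ))
          = if dirs α rfl ∘ σ = dirs β hβ then a β else 0 := by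
      intro β hβ
      rw [smul_apply, dirForm_apply]
      split_ifs with hs
      · rw [Finset.prod_eq_one, smul_eq_mul, mul_one]
        intro j _
        rw [← congrFun hs j]
        simp
      · obtain ⟨j, hj⟩ := Function.ne_iff.1 hs
        rw [Finset.prod_eq_zero (Finset.mem_univ j), smul_zero]
        rw [Pi.single_apply, if_neg fun h => hj h.symm]
    rw [Finset.sum_eq_single ⟨α, by simp⟩]
    · exact hterm α rfl
    · intro β _ hne
      rw [hterm, if_neg]
      intro hs
      exact hne (Subtype.ext (dirs_comp_perm_eq _ _ σ hs).symm)
    · simp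
  simp only [key]
  rw [← Finset.sum_filter, Finset.sum_const, nsmul_eq_mul, mul_comm]
  congr 2
  rw [← Fintype.card_subtype, DomMulAct.stabilizer_card]
  exact Finset.prod_congr rfl fun i _ => by rw [card_dirs]

theorem taylorCoeff_congr {n : ℕ} {f g : (Fin n → ℂ) → ℂ} (h : f =ᶠ[𝓝 0] g) :
    taylorCoeff f = taylorCoeff g := by
  funext α
  unfold taylorCoeff partialDeriv
  rw [(h.iteratedFDeriv ℂ (∑ i, α i)).eq_of_nhds]

theorem CoeffBound.taylorCoeff_tsum {n : ℕ} {a : (Fin n → ℕ) → ℂ} {C : ℝ} {s : ℕ}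
    (h : CoeffBound a C s) : taylorCoeff (fun z => ∑' α, a α * monomialEval z α) = a :=
  funext fun α => taylorCoeff_of_hasFPowerSeriesOnBall h.hasFPowerSeriesOnBall α

/-- The multi-index counting the values of a list of directions. -/
def countDirs {n k : ℕ} (φ : Fin k → Fin n) (i : Fin n) : ℕ :=
  (Finset.univ.filter fun j => φ j = i).card

theorem sum_countDirs {n k : ℕ} (φ : Fin k → Fin n) : ∑ i, countDirs φ i = k := by
  simpa [countDirs] using (Finset.card_eq_sum_card_fiberwise (f := φ) (s := Finset.univ)
    (t := Finset.univ) (by simp [Set.MapsTo])).symm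

theorem prod_comp_eq_monomialEval {n k : ℕ} (φ : Fin k → Fin n) (z : Fin n → ℂ) :
    ∏ j, z (φ j) = monomialEval z (countDirs φ) := by
  rw [← Finset.prod_fiberwise Finset.univ φ]
  refine Finset.prod_congr rfl fun i _ => ?_
  rw [Finset.prod_congr rfl fun j hj => by rw [(Finset.mem_filter.1 hj).2],
    Finset.prod_const, countDirs]

/-- The coefficient of `z ^ α` in the homogeneous polynomial `p k (z, …, z)`. -/
noncomputable def seriesCoeff {n : ℕ} (p : FormalMultilinearSeries ℂ (Fin n → ℂ) ℂ) (k : ℕ)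
    (α : Fin n → ℕ) : ℂ :=
  ∑ φ : Fin k → Fin n with countDirs φ = α, p k fun j => Pi.single (φ j) 1

/-- Expand `z` in the standard basis and collect the words in the basis vectors by their letter
counts. -/
theorem series_apply_diag {n : ℕ} (p : FormalMultilinearSeries ℂ (Fin n → ℂ) ℂ) (k : ℕ)
    (z : Fin n → ℂ) : p k (fun _ => z) =
      ∑ α ∈ Finset.piAntidiag Finset.univ k, seriesCoeff p (∑ i, α i) α * monomialEval z α := by
  have hz : z = ∑ i, z i • (Pi.single i 1 : Fin n → ℂ) := by
    funext l
    simp [Finset.sum_apply, Pi.single_apply]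
  have h1 : p k (fun _ => z) =
      ∑ φ : Fin k → Fin n, (p k fun j => Pi.single (φ j) 1) * monomialEval z (countDirs φ) := by
    conv_lhs => rw [hz]
    rw [ContinuousMultilinearMap.map_sum]
    refine Finset.sum_congr rfl fun φ _ => ?_
    rw [ContinuousMultilinearMap.map_smul_univ, prod_comp_eq_monomialEval, smul_eq_mul, mul_comm]
  rw [h1, ← Finset.sum_fiberwise_of_maps_to (g := countDirs)
    (t := Finset.piAntidiag Finset.univ k)]
  · refine Finset.sum_congr rfl fun α hα => ?_
    rw [(Finset.mem_piAntidiag.1 hα).1, seriesCoeff, Finset.sum_mul]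
    exact Finset.sum_congr rfl fun φ hφ => by rw [(Finset.mem_filter.1 hφ).2]
  · intro φ _
    simp [sum_countDirs]

theorem norm_seriesCoeff_le {n : ℕ} (p : FormalMultilinearSeries ℂ (Fin n → ℂ) ℂ) (k : ℕ)
    (α : Fin n → ℕ) : ‖seriesCoeff p k α‖ ≤ (n : ℝ) ^ k * ‖p k‖ := by
  refine (norm_sum_le _ _).trans ?_
  have h1 : ∀ φ : Fin k → Fin n, ‖p k fun j => (Pi.single (φ j) 1 : Fin n → ℂ)‖ ≤ ‖p k‖ :=
    fun φ => ((p k).le_opNorm _).trans_eq (by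
      rw [Finset.prod_eq_one, mul_one]
      intro j _
      rw [Pi.norm_single, norm_one])
  refine (Finset.sum_le_sum fun φ _ => h1 φ).trans ?_
  rw [Finset.sum_const, nsmul_eq_mul]
  refine mul_le_mul_of_nonneg_right ?_ (norm_nonneg _)
  refine (Nat.cast_le.2 (Finset.card_le_univ _)).trans ?_
  simp

theorem exists_coeffBound_of_geometric {n : ℕ} {a : (Fin n → ℕ) → ℂ} {C R : ℝ} (hR : 0 ≤ R)
    (h : ∀ α, ‖a α‖ ≤ C * R ^ (∑ i, α i)) : ∃ s, CoeffBound a C s := by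
  have hC : 0 ≤ C := by simpa using (norm_nonneg _).trans (h 0)
  obtain ⟨s, hs⟩ := pow_unbounded_of_one_lt R one_lt_two
  refine ⟨s, fun α => (h α).trans (mul_le_mul_of_nonneg_left ?_ hC)⟩
  calc R ^ (∑ i, α i) ≤ ((2 : ℝ) ^ s) ^ (∑ i, α i) := pow_le_pow_left₀ hR hs.le _
    _ = ((2 : ℝ) ^ (∑ i, α i)) ^ s := by rw [← pow_mul, ← pow_mul, mul_comm]
    _ ≤ (primeSize α : ℝ) ^ s := by
      gcongr
      exact_mod_cast two_pow_le_primeSize α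

/-- Taylor expansion of a function holomorphic near the origin. -/
theorem AnalyticAt.exists_coeffBound {n : ℕ} {f : (Fin n → ℂ) → ℂ} (hf : AnalyticAt ℂ f 0) :
    ∃ C s, CoeffBound (taylorCoeff f) C s ∧
      f =ᶠ[𝓝 0] fun z => ∑' α, taylorCoeff f α * monomialEval z α := by
  obtain ⟨p, r, hp⟩ := hf
  set a : (Fin n → ℕ) → ℂ := fun α => seriesCoeff p (∑ i, α i) α with ha
  obtain ⟨ρ, hρ0, hρ⟩ := ENNReal.lt_iff_exists_nnreal_btwn.1 hp.r_pos
  have hρ0' : 0 < ρ := by exact_mod_cast hρ0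
  obtain ⟨C, hC0, hC⟩ := p.norm_le_div_pow_of_pos_of_lt_radius hρ0' (hρ.trans_le hp.r_le)
  obtain ⟨s, hs⟩ : ∃ s, CoeffBound a C s := by
    -- The factor `n ^ k` counts the words of length `k`; `ρ ^ (-k)` is the decay of the series
    -- inside its radius.
    refine exists_coeffBound_of_geometric (R := n / ρ) (by positivity) fun α => ?_
    refine (norm_seriesCoeff_le p _ α).trans ?_
    refine (mul_le_mul_of_nonneg_left (hC _) (by positivity)).trans (le_of_eq ?_)
    rw [div_pow]
    ring
  have hev : f =ᶠ[𝓝 0] fun z => ∑' α, a α * monomialEval z α := by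
    have h1 : ∀ᶠ z : Fin n → ℂ in 𝓝 0, z ∈ Metric.eball (0 : Fin n → ℂ) r :=
      Metric.eball_mem_nhds _ hp.r_pos
    have h2 : ∀ᶠ z : Fin n → ℂ in 𝓝 0, z ∈ Metric.ball (0 : Fin n → ℂ) (polyradius n (s + 2)) :=
      Metric.ball_mem_nhds _ (polyradius_pos _ _)
    filter_upwards [h1, h2] with z hz1 hz2
    have h3 := hp.hasSum hz1
    rw [zero_add] at h3
    simp only [series_apply_diag] at h3
    exact h3.unique (hasSum_degree (hs.summable_norm
      (by simpa using (Metric.mem_ball.1 hz2).le)).of_norm)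
  have hcoef : taylorCoeff f = a := (taylorCoeff_congr hev).trans hs.taylorCoeff_tsum
  rw [hcoef]
  exact ⟨C, s, hs, hev⟩

theorem pairing_eq_tsum {n : ℕ} (ξ : (Fin n → ℕ) → ℂ) (f : (Fin n → ℂ) → ℂ) :
    pairing ξ f 0 = ∑' α, ξ α * taylorCoeff f α := rfl

theorem summable_pairing {n : ℕ} {ξ : (Fin n → ℕ) → ℂ} (hξ : ξ ∈ ell1 n)
    {f : (Fin n → ℂ) → ℂ} (hf : AnalyticAt ℂ f 0) : Summable fun α => ξ α * taylorCoeff f α := by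
  obtain ⟨C, s, hs, -⟩ := hf.exists_coeffBound
  have hP : 0 < Nat.nth Nat.Prime n := (Nat.prime_nth_prime n).pos
  refine Summable.of_norm_bounded
    ((hξ ((Nat.nth Nat.Prime n : ℝ) ^ s) (by positivity)).mul_left C) fun α => ?_
  rw [norm_mul, mul_left_comm]
  refine mul_le_mul_of_nonneg_left ((hs α).trans ?_) (norm_nonneg _)
  refine mul_le_mul_of_nonneg_left ?_ hs.nonneg
  rw [← pow_mul, mul_comm, pow_mul]
  gcongr
  exact_mod_cast primeSize_le α

/-! ### Germs and their coefficients -/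

/-- Taylor coefficients of a germ. -/
noncomputable def germCoeff {n : ℕ} (F : HolGerm n) : (Fin n → ℕ) → ℂ :=
  Germ.liftOn (F : Germ (𝓝 (0 : Fin n → ℂ)) ℂ) taylorCoeff fun _ _ h => taylorCoeff_congr h

/-- The germ of a function holomorphic near the origin. -/
noncomputable def HolGerm.mk {n : ℕ} (f : (Fin n → ℂ) → ℂ) (hf : AnalyticAt ℂ f 0) : HolGerm n :=
  ⟨(f : Germ (𝓝 (0 : Fin n → ℂ)) ℂ), f, hf, rfl⟩

theorem HolGerm.exists_eq_mk {n : ℕ} (F : HolGerm n) :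
    ∃ (f : (Fin n → ℂ) → ℂ) (hf : AnalyticAt ℂ f 0), F = HolGerm.mk f hf := by
  obtain ⟨f, hf, h⟩ := F.2
  exact ⟨f, hf, Subtype.ext h.symm⟩

theorem HolGerm.mk_eq_mk {n : ℕ} {f g : (Fin n → ℂ) → ℂ} {hf : AnalyticAt ℂ f 0}
    {hg : AnalyticAt ℂ g 0} : HolGerm.mk f hf = HolGerm.mk g hg ↔ f =ᶠ[𝓝 0] g := by
  rw [Subtype.ext_iff]
  exact Germ.coe_eq

theorem germCoeff_mk {n : ℕ} {f : (Fin n → ℂ) → ℂ} (hf : AnalyticAt ℂ f 0) :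
    germCoeff (HolGerm.mk f hf) = taylorCoeff f := rfl

theorem germPairing_eq_tsum {n : ℕ} (ξ : (Fin n → ℕ) → ℂ) (F : HolGerm n) :
    germPairing ξ F = ∑' α, ξ α * germCoeff F α := by
  obtain ⟨f, hf, rfl⟩ := HolGerm.exists_eq_mk F
  rfl

theorem taylorCoeff_add {n : ℕ} {f g : (Fin n → ℂ) → ℂ} (hf : AnalyticAt ℂ f 0)
    (hg : AnalyticAt ℂ g 0) : taylorCoeff (f + g) = taylorCoeff f + taylorCoeff g := by
  funext α
  simp only [taylorCoeff, partialDeriv, Pi.add_apply]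
  rw [iteratedFDeriv_add_apply hf.contDiffAt hg.contDiffAt, add_apply, add_div]

theorem taylorCoeff_smul {n : ℕ} {f : (Fin n → ℂ) → ℂ} (hf : AnalyticAt ℂ f 0) (c : ℂ) :
    taylorCoeff (c • f) = c • taylorCoeff f := by
  funext α
  simp only [taylorCoeff, partialDeriv, Pi.smul_apply]
  rw [iteratedFDeriv_const_smul_apply hf.contDiffAt, smul_apply, smul_eq_mul, smul_eq_mul,
    mul_div_assoc]

theorem germCoeff_add {n : ℕ} (F G : HolGerm n) : germCoeff (F + G) = germCoeff F + germCoeff G := by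
  obtain ⟨f, hf, rfl⟩ := HolGerm.exists_eq_mk F
  obtain ⟨g, hg, rfl⟩ := HolGerm.exists_eq_mk G
  exact taylorCoeff_add hf hg

/-- The germ of a constant function. -/
noncomputable def HolGerm.const (n : ℕ) (c : ℂ) : HolGerm n := HolGerm.mk (fun _ => c) analyticAt_const

theorem germCoeff_const_mul {n : ℕ} (c : ℂ) (F : HolGerm n) :
    germCoeff (HolGerm.const n c * F) = c • germCoeff F := by
  obtain ⟨f, hf, rfl⟩ := HolGerm.exists_eq_mk F
  exact taylorCoeff_smul hf c

theorem germCoeff_sub {n : ℕ} (F G : HolGerm n) : germCoeff (F - G) = germCoeff F - germCoeff G := by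
  rw [eq_sub_iff_add_eq, ← germCoeff_add, sub_add_cancel]

theorem germCoeff_injective {n : ℕ} : Function.Injective (germCoeff (n := n)) := by
  intro F G h
  obtain ⟨f, hf, rfl⟩ := HolGerm.exists_eq_mk F
  obtain ⟨g, hg, rfl⟩ := HolGerm.exists_eq_mk G
  obtain ⟨_, _, -, hf'⟩ := hf.exists_coeffBound
  obtain ⟨_, _, -, hg'⟩ := hg.exists_coeffBound
  rw [germCoeff_mk, germCoeff_mk] at h
  rw [HolGerm.mk_eq_mk]
  rw [h] at hf'
  exact hf'.trans hg'.symm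

/-! ### Operators on absolutely summable families -/

section SummableFamilies

variable {ι F : Type*} [NormedAddCommGroup F] [NormedSpace ℂ F] [CompleteSpace F]

theorem lp_one_summable_norm (h : lp (fun _ : ι => ℂ) 1) : Summable fun i => ‖h i‖ := by
  simpa using (lp.memℓp h).summable (by simp)

theorem lp_one_norm_eq_tsum (h : lp (fun _ : ι => ℂ) 1) : ‖h‖ = ∑' i, ‖h i‖ := by
  simpa using lp.norm_eq_tsum_rpow (p := 1) (by simp) h

theorem lp_one_summable_smul (h : lp (fun _ : ι => ℂ) 1) {v : ι → F} {c : ℝ}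
    (hv : ∀ i, ‖v i‖ ≤ c) : Summable fun i => h i • v i :=
  Summable.of_norm_bounded ((lp_one_summable_norm h).mul_right c) fun i => by
    rw [norm_smul]
    exact mul_le_mul_of_nonneg_left (hv i) (norm_nonneg _)

/-- The bounded operator `h ↦ ∑ i, h i • v i` on `ℓ¹` attached to a bounded family of vectors. -/
noncomputable def lpOneLift (v : ι → F) (c : ℝ) (hv : ∀ i, ‖v i‖ ≤ c) :
    lp (fun _ : ι => ℂ) 1 →L[ℂ] F :=
  LinearMap.mkContinuous
    { toFun := fun h => ∑' i, h i • v i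
      map_add' := fun h k => by
        rw [← (lp_one_summable_smul h hv).tsum_add (lp_one_summable_smul k hv)]
        exact tsum_congr fun i => add_smul _ _ _
      map_smul' := fun a h => by
        rw [RingHom.id_apply, ← (lp_one_summable_smul h hv).tsum_const_smul]
        exact tsum_congr fun i => mul_smul _ _ _ } c fun h => by
    rw [lp_one_norm_eq_tsum, ← tsum_mul_left]
    refine tsum_of_norm_bounded ((lp_one_summable_norm h).mul_left c).hasSum fun i => ?_
    rw [norm_smul, mul_comm]
    exact mul_le_mul_of_nonneg_right (hv i) (norm_nonneg _)

theorem lpOneLift_apply (v : ι → F) (c : ℝ) (hv : ∀ i, ‖v i‖ ≤ c) (h : lp (fun _ : ι => ℂ) 1) :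
    lpOneLift v c hv h = ∑' i, h i • v i := rfl

theorem lpOneLift_hasSum (v : ι → F) (c : ℝ) (hv : ∀ i, ‖v i‖ ≤ c)
    (h : lp (fun _ : ι => ℂ) 1) : HasSum (fun i => h i • v i) (lpOneLift v c hv h) :=
  (lp_one_summable_smul h hv).hasSum

theorem norm_lpOneLift_le (v : ι → F) {c : ℝ} (hc : 0 ≤ c) (hv : ∀ i, ‖v i‖ ≤ c) :
    ‖lpOneLift v c hv‖ ≤ c :=
  LinearMap.mkContinuous_norm_le _ hc _

theorem lpOneLift_single [DecidableEq ι] (v : ι → F) (c : ℝ) (hv : ∀ i, ‖v i‖ ≤ c) (i : ι) :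
    lpOneLift v c hv (lp.single 1 i 1) = v i := by
  rw [lpOneLift_apply, tsum_eq_single i]
  · simp
  · intro j hj
    simp [hj]

end SummableFamilies

/-! ### Division of convergent power series -/

/-- The value of the power series with coefficients `a`. -/
noncomputable def seriesEval {n : ℕ} (a : (Fin n → ℕ) → ℂ) (z : Fin n → ℂ) : ℂ :=
  ∑' α, a α * monomialEval z α

theorem CoeffBound.hasSum_seriesEval {n : ℕ} {a : (Fin n → ℕ) → ℂ} {C : ℝ} {s : ℕ}
    (h : CoeffBound a C s) {z : Fin n → ℂ} (hz : ‖z‖ ≤ polyradius n (s + 2)) :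
    HasSum (fun α => a α * monomialEval z α) (seriesEval a z) :=
  (h.summable_norm hz).of_norm.hasSum

theorem polyradius_anti (n : ℕ) {s t : ℕ} (h : s ≤ t) : polyradius n t ≤ polyradius n s := by
  have hP : (1 : ℝ) ≤ Nat.nth Nat.Prime n := by exact_mod_cast (Nat.prime_nth_prime n).one_le
  unfold polyradius
  gcongr

/-- The relative weights of the terms of `g` other than `z ^ γ`. -/
noncomputable def tailWeight {n : ℕ} (g : (Fin n → ℕ) → ℂ) (γ : Fin n → ℕ) (t : ℕ)
    (δ : Fin n → ℕ) : ℂ := by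
  classical
  exact if δ = γ then 0 else g δ * ((primeSize γ : ℂ) ^ t / (primeSize δ : ℂ) ^ t)

/-- Every surviving `δ` has size at least `primeSize γ + 1`, as sizes are integers. The exponent `s
+ 2` pays for the growth of `g` and for summability, and each of the `m` further powers gains a
fixed ratio below 1. -/
theorem norm_tailWeight_le {n : ℕ} {g : (Fin n → ℕ) → ℂ} {γ : Fin n → ℕ} {C : ℝ} {s : ℕ}
    (hg : CoeffBound g C s) (h0 : ∀ δ, primeSize δ < primeSize γ → g δ = 0) (m : ℕ)
    (δ : Fin n → ℕ) : ‖tailWeight g γ (s + 2 + m) δ‖ ≤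
      (C * (primeSize γ : ℝ) ^ (s + 2) * ((primeSize γ : ℝ) / (primeSize γ + 1)) ^ m) *
        ((primeSize δ : ℝ) ^ 2)⁻¹ := by
  have hC := hg.nonneg
  have hγ := one_le_primeSize γ
  have hδ := one_le_primeSize δ
  unfold tailWeight
  split_ifs with h
  · rw [norm_zero]
    positivity
  rcases lt_trichotomy (primeSize δ) (primeSize γ) with hlt | heq | hgt
  · rw [h0 δ hlt, zero_mul, norm_zero]
    positivity
  · exact absurd (primeSize_injective heq) h
  · have hgt' : (primeSize γ : ℝ) + 1 ≤ primeSize δ := by exact_mod_cast hgt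
    rw [norm_mul, norm_div, norm_pow, norm_pow, Complex.norm_natCast, Complex.norm_natCast]
    calc ‖g δ‖ * ((primeSize γ : ℝ) ^ (s + 2 + m) / (primeSize δ : ℝ) ^ (s + 2 + m))
        ≤ (C * (primeSize δ : ℝ) ^ s) *
          ((primeSize γ : ℝ) ^ (s + 2 + m) / (primeSize δ : ℝ) ^ (s + 2 + m)) :=
          mul_le_mul_of_nonneg_right (hg δ) (by positivity)
      _ = (C * (primeSize γ : ℝ) ^ (s + 2) * ((primeSize δ : ℝ) ^ 2)⁻¹) *
          ((primeSize γ : ℝ) / primeSize δ) ^ m := by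
          have : (primeSize δ : ℝ) ≠ 0 := by positivity
          rw [pow_add, pow_add _ (s + 2) m, pow_add _ s 2, pow_add _ s 2, div_pow]
          field_simp
      _ ≤ (C * (primeSize γ : ℝ) ^ (s + 2) * ((primeSize δ : ℝ) ^ 2)⁻¹) *
          ((primeSize γ : ℝ) / (primeSize γ + 1)) ^ m := by
          gcongr
      _ = _ := by ring

theorem eventually_tsum_tailWeight_le {n : ℕ} {g : (Fin n → ℕ) → ℂ} {γ : Fin n → ℕ} {C : ℝ}
    {s : ℕ} (hg : CoeffBound g C s) (h0 : ∀ δ, primeSize δ < primeSize γ → g δ = 0) :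
    ∀ᶠ t : ℕ in atTop, Summable (fun δ => ‖tailWeight g γ t δ‖) ∧
      ∑' δ, ‖tailWeight g γ t δ‖ ≤ 1 / 2 := by
  have hγ := one_le_primeSize γ
  set S : ℝ := ∑' δ : Fin n → ℕ, ((primeSize δ : ℝ) ^ 2)⁻¹
  have hlim : Tendsto (fun m : ℕ => (C * (primeSize γ : ℝ) ^ (s + 2) *
      ((primeSize γ : ℝ) / (primeSize γ + 1)) ^ m) * S) atTop (𝓝 0) := by
    have h1 := tendsto_pow_atTop_nhds_zero_of_lt_one (r := (primeSize γ : ℝ) / (primeSize γ + 1))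
      (by positivity) (by rw [div_lt_one (by positivity)]; linarith)
    simpa using (h1.const_mul (C * (primeSize γ : ℝ) ^ (s + 2))).mul_const S
  have hev : ∀ᶠ m : ℕ in atTop, Summable (fun δ => ‖tailWeight g γ (s + 2 + m) δ‖) ∧
      ∑' δ, ‖tailWeight g γ (s + 2 + m) δ‖ ≤ 1 / 2 := by
    filter_upwards [hlim.eventually (gt_mem_nhds (show (0 : ℝ) < 1 / 2 by norm_num))] with m hm
    have hsum : Summable (fun δ => ‖tailWeight g γ (s + 2 + m) δ‖) :=
      Summable.of_nonneg_of_le (fun _ => norm_nonneg _) (norm_tailWeight_le hg h0 m)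
        ((summable_primeSize n).mul_left _)
    refine ⟨hsum, le_trans ?_ hm.le⟩
    rw [← tsum_mul_left]
    exact hsum.tsum_le_tsum (norm_tailWeight_le hg h0 m) ((summable_primeSize n).mul_left _)
  obtain ⟨m₀, hm₀⟩ := eventually_atTop.1 hev
  refine eventually_atTop.2 ⟨s + 2 + m₀, fun t ht => ?_⟩
  obtain ⟨m, rfl⟩ := Nat.exists_eq_add_of_le ht
  rw [add_assoc]
  exact hm₀ _ (Nat.le_add_right _ _)

/-- The weighted monomial `z ↦ N(α)ᵗ z ^ α`. -/
noncomputable def weightedMonomial {n : ℕ} (t : ℕ) (z : Fin n → ℂ) (α : Fin n → ℕ) : ℂ :=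
  (primeSize α : ℂ) ^ t * monomialEval z α

theorem norm_weightedMonomial_le {n t : ℕ} {z : Fin n → ℂ} (hz : ‖z‖ ≤ polyradius n t)
    (α : Fin n → ℕ) : ‖weightedMonomial t z α‖ ≤ 1 := by
  have h1 := one_le_primeSize α
  rw [weightedMonomial, norm_mul, norm_pow, Complex.norm_natCast]
  refine (mul_le_mul_of_nonneg_left (norm_monomialEval_le_primeSize hz α)
    (by positivity)).trans (le_of_eq ?_)
  exact mul_inv_cancel₀ (by positivity)

/-- Grauert's division theorem for convergent power series, with respect to the order of
monomials by `primeSize`. -/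
theorem exists_division {n : ℕ} (Γ : Finset (Fin n → ℕ)) (g : (Fin n → ℕ) → (Fin n → ℕ) → ℂ)
    {C : ℝ} {s : ℕ} (hg1 : ∀ γ ∈ Γ, g γ γ = 1)
    (hg0 : ∀ γ ∈ Γ, ∀ δ, primeSize δ < primeSize γ → g γ δ = 0)
    (hgb : ∀ γ ∈ Γ, CoeffBound (g γ) C s) {a : (Fin n → ℕ) → ℂ} (ha : CoeffBound a C s) :
    ∃ (t : ℕ) (q : (Fin n → ℕ) → (Fin n → ℕ) → ℂ) (r : (Fin n → ℕ) → ℂ),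
      (∀ γ ∈ Γ, ∃ C', CoeffBound (q γ) C' t) ∧ (∃ C', CoeffBound r C' t) ∧
      (∀ α, (∃ γ ∈ Γ, γ ≤ α) → r α = 0) ∧ ∀ z : Fin n → ℂ, ‖z‖ ≤ polyradius n (t + 2) →
        seriesEval a z = ∑ γ ∈ Γ, seriesEval (q γ) z * seriesEval (g γ) z + seriesEval r z := by
  classical
  -- A large `t` makes every divisor a small perturbation of its initial monomial; `t ≥ s + 2` also
  -- puts the normalized coefficients of `a` in `ℓ¹`.
  obtain ⟨t, htail, hts⟩ := (((eventually_all_finset Γ).2 fun γ hγ =>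
    eventually_tsum_tailWeight_le (hgb γ hγ) (hg0 γ hγ)).and (eventually_ge_atTop (s + 2))).exists
  set up : (Fin n → ℕ) → Prop := fun α => ∃ γ ∈ Γ, γ ≤ α with hup
  -- Assign to each divisible exponent a single divisor, so that no term is divided twice.
  choose! i hiΓ hile using fun (α : Fin n → ℕ) (h : up α) => h
  set L := lp (fun _ : Fin n → ℕ => ℂ) 1
  have hsingle : ∀ δ : Fin n → ℕ, ‖(lp.single 1 δ 1 : L)‖ = 1 := fun δ => by
    rw [lp.norm_single (by simp)]; simp
  have hdsum : ∀ α, up α → Summable fun δ =>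
      tailWeight (g (i α)) (i α) t δ • (lp.single 1 (δ + (α - i α)) 1 : L) := by
    intro α hα
    refine Summable.of_norm_bounded (htail (i α) (hiΓ α hα)).1 fun δ => ?_
    rw [norm_smul, hsingle, mul_one]
  -- The basis vector at `α` stands for `N(α)ᵗ z^α`. In these coordinates `d α` is the tail of
  -- `N(α)ᵗ z^(α - i α) g_(i α)`; by multiplicativity of `N`, its weights do not depend on `α - i
  -- α`.
  set d : (Fin n → ℕ) → L := fun α => if up α then
    ∑' δ, tailWeight (g (i α)) (i α) t δ • (lp.single 1 (δ + (α - i α)) 1 : L) else 0 with hd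
  have hdn : ∀ α, ‖d α‖ ≤ 1 / 2 := by
    intro α
    by_cases hα : up α
    · simp only [hd, if_pos hα]
      refine le_trans ?_ (htail (i α) (hiΓ α hα)).2
      refine tsum_of_norm_bounded (htail (i α) (hiΓ α hα)).1.hasSum fun δ => ?_
      rw [norm_smul, hsingle, mul_one]
    · simp only [hd, if_neg hα, norm_zero]
      norm_num
  set T : L →L[ℂ] L := lpOneLift d (1 / 2) hdn with hT
  have hTn : ‖-T‖ < 1 := by
    rw [norm_neg]
    exact (norm_lpOneLift_le d (by norm_num) hdn).trans_lt (by norm_num)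
  have hâ : Memℓp (fun α => a α * ((primeSize α : ℂ) ^ t)⁻¹) 1 := by
    refine memℓp_gen ?_
    simp only [ENNReal.toReal_one, Real.rpow_one]
    refine Summable.of_nonneg_of_le (fun _ => norm_nonneg _) (fun α => ?_)
      ((summable_primeSize n).mul_left C)
    have h1 := one_le_primeSize α
    rw [norm_mul, norm_inv, norm_pow, Complex.norm_natCast]
    calc ‖a α‖ * ((primeSize α : ℝ) ^ t)⁻¹
        ≤ (C * (primeSize α : ℝ) ^ s) * ((primeSize α : ℝ) ^ (s + 2))⁻¹ :=
          mul_le_mul (ha α) (inv_anti₀ (by positivity) (pow_le_pow_right₀ h1 hts))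
            (by positivity) (mul_nonneg ha.nonneg (by positivity))
      _ = C * ((primeSize α : ℝ) ^ 2)⁻¹ := by
          have : (primeSize α : ℝ) ≠ 0 := by positivity
          rw [pow_add]
          field_simp
  -- The operator `1 + T` replaces each divisible monomial by the corresponding multiple of a
  -- divisor and fixes the others. Since `‖T‖ ≤ 1 / 2`, a Neumann series inverts it.
  obtain ⟨h, hh⟩ : ∃ h : L, h + T h = ⟨_, hâ⟩ := by
    obtain ⟨u, hu⟩ := isUnit_one_sub_of_norm_lt_one hTn
    refine ⟨(↑u⁻¹ : L →L[ℂ] L) ⟨_, hâ⟩, ?_⟩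
    have h1 : ((u : L →L[ℂ] L) * (↑u⁻¹ : L →L[ℂ] L)) ⟨_, hâ⟩ = ⟨_, hâ⟩ := by
      rw [u.mul_inv]; rfl
    rw [hu] at h1
    simpa using h1
  have hhn : ∀ α, ‖h α‖ ≤ ‖h‖ := fun α => lp.norm_apply_le_norm (by simp) h α
  set q : (Fin n → ℕ) → (Fin n → ℕ) → ℂ := fun γ κ =>
    if i (κ + γ) = γ then h (κ + γ) * (primeSize (κ + γ) : ℂ) ^ t else 0 with hq
  set r : (Fin n → ℕ) → ℂ := fun α => if up α then 0 else h α * (primeSize α : ℂ) ^ t with hr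
  have hqb : ∀ γ, CoeffBound (q γ) (‖h‖ * (primeSize γ : ℝ) ^ t) t := by
    intro γ κ
    simp only [hq]
    split_ifs
    · rw [norm_mul, norm_pow, Complex.norm_natCast, primeSize_add, Nat.cast_mul, mul_pow,
        mul_comm ((primeSize κ : ℝ) ^ t), ← mul_assoc]
      gcongr
      exact hhn _
    · rw [norm_zero]
      positivity
  have hrb : CoeffBound r ‖h‖ t := by
    intro α
    simp only [hr]
    split_ifs
    · rw [norm_zero]
      positivity
    · rw [norm_mul, norm_pow, Complex.norm_natCast]
      gcongr
      exact hhn _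
  refine ⟨t, q, r, fun γ _ => ⟨_, hqb γ⟩, ⟨_, hrb⟩, fun α hα => if_pos hα, fun z hz => ?_⟩
  have hzt : ‖z‖ ≤ polyradius n t := hz.trans (polyradius_anti n (by omega))
  have hzs : ‖z‖ ≤ polyradius n (s + 2) := hzt.trans (polyradius_anti n hts)
  have hp0 : ∀ α : Fin n → ℕ, (primeSize α : ℂ) ^ t ≠ 0 := fun α =>
    pow_ne_zero _ (Nat.cast_ne_zero.2 (primeSize_pos α).ne')
  set ev : L →L[ℂ] ℂ := lpOneLift (weightedMonomial t z) 1 (norm_weightedMonomial_le hzt) with hev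
  have heva : ev ⟨_, hâ⟩ = seriesEval a z := by
    rw [hev, lpOneLift_apply]
    refine tsum_congr fun α => ?_
    change (a α * ((primeSize α : ℂ) ^ t)⁻¹) * ((primeSize α : ℂ) ^ t * monomialEval z α) = _
    have := hp0 α
    field_simp
  have hevd : ∀ α, up α → weightedMonomial t z α + ev (d α) =
      (primeSize α : ℂ) ^ t * monomialEval z (α - i α) * seriesEval (g (i α)) z := by
    intro α hα
    have hαi : α - i α + i α = α := tsub_add_cancel_of_le (hile α hα)
    have hγ := hiΓ α hα
    have h1 : HasSum (fun δ => ev (tailWeight (g (i α)) (i α) t δ •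
        (lp.single 1 (δ + (α - i α)) 1 : L))) (ev (d α)) := by
      simp only [hd, if_pos hα]
      exact ev.hasSum (hdsum α hα).hasSum
    have h2 := hasSum_ite_eq (i α) (weightedMonomial t z α)
    have h3 := ((hgb (i α) hγ).hasSum_seriesEval hzs).mul_left
      ((primeSize α : ℂ) ^ t * monomialEval z (α - i α))
    refine (h2.add h1).unique ?_
    convert! h3 using 2 with δ
    rw [map_smul, hev, lpOneLift_single, smul_eq_mul]
    unfold tailWeight weightedMonomial
    by_cases hδ : δ = i α
    · subst hδ
      rw [if_pos rfl, if_pos rfl, hg1 _ hγ]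
      conv_lhs => rw [← hαi]
      rw [monomialEval_add, hαi]
      ring
    · rw [if_neg hδ, if_neg hδ]
      have h4 : (primeSize α : ℂ) ^ t
          = (primeSize (α - i α) : ℂ) ^ t * (primeSize (i α) : ℂ) ^ t := by
        rw [← mul_pow, ← Nat.cast_mul, ← primeSize_add, hαi]
      rw [h4, monomialEval_add, primeSize_add, Nat.cast_mul, mul_pow]
      have := hp0 δ
      field_simp
      ring
  have htotal : HasSum (fun α => h α * (weightedMonomial t z α + ev (d α))) (seriesEval a z) := by
    rw [← heva, ← hh, map_add]
    have h1 := lpOneLift_hasSum _ _ (norm_weightedMonomial_le hzt) h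
    have h2 := ev.hasSum (lpOneLift_hasSum _ _ hdn h)
    convert! h1.add h2 using 2 with α
    rw [map_smul, smul_eq_mul, smul_eq_mul, mul_add]
  refine htotal.unique ?_
  -- Regroup the expansion by assigned divisor, reindexing the exponents above `γ` as `κ + γ`.
  have hA : ∀ γ ∈ Γ, HasSum (fun α => if up α ∧ i α = γ then
      h α * ((primeSize α : ℂ) ^ t * monomialEval z (α - γ)) * seriesEval (g γ) z else 0)
      (seriesEval (q γ) z * seriesEval (g γ) z) := by
    intro γ hγ
    have h1 := ((hqb γ).hasSum_seriesEval hz).mul_right (seriesEval (g γ) z)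
    refine ((add_left_injective γ).hasSum_iff ?_).1 ?_
    · intro α hα
      refine if_neg fun hc => hα ⟨α - γ, ?_⟩
      rw [← hc.2]
      exact tsub_add_cancel_of_le (hile α hc.1)
    · convert! h1 using 2 with κ
      have hupκ : up (κ + γ) := ⟨γ, hγ, le_add_of_nonneg_left zero_le⟩
      simp only [Function.comp, hq, hupκ, true_and, add_tsub_cancel_right]
      split_ifs
      · ring
      · simp
  have hR := hrb.hasSum_seriesEval hz
  convert! (hasSum_sum hA).add hR using 2 with α
  by_cases hα : up α
  · rw [hevd α hα, Finset.sum_eq_single (i α)]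
    · simp only [hr, if_pos hα, hα, true_and, if_true]
      ring
    · intro γ _ hne
      exact if_neg fun hc => hne hc.2.symm
    · exact fun hc => absurd (hiΓ α hα) hc
  · simp only [hα, false_and, if_false, Finset.sum_const_zero, hr, hd, map_zero, add_zero,
      zero_add, weightedMonomial]
    ring

theorem CoeffBound.analyticAt {n : ℕ} {a : (Fin n → ℕ) → ℂ} {C : ℝ} {s : ℕ}
    (h : CoeffBound a C s) : AnalyticAt ℂ (seriesEval a) 0 :=
  h.hasFPowerSeriesOnBall.analyticAt

theorem CoeffBound.taylorCoeff_seriesEval {n : ℕ} {a : (Fin n → ℕ) → ℂ} {C : ℝ} {s : ℕ}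
    (h : CoeffBound a C s) : taylorCoeff (seriesEval a) = a := h.taylorCoeff_tsum

theorem exists_coeffBound_germCoeff {n : ℕ} (F : HolGerm n) :
    ∃ C s, CoeffBound (germCoeff F) C s := by
  obtain ⟨f, hf, rfl⟩ := HolGerm.exists_eq_mk F
  obtain ⟨C, s, h, -⟩ := hf.exists_coeffBound
  exact ⟨C, s, h⟩

theorem coe_germ_eq_seriesEval {n : ℕ} (F : HolGerm n) :
    (F : Germ (𝓝 (0 : Fin n → ℂ)) ℂ) = (seriesEval (germCoeff F) : (Fin n → ℂ) → ℂ) := by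
  obtain ⟨f, hf, rfl⟩ := HolGerm.exists_eq_mk F
  obtain ⟨C, s, -, h⟩ := hf.exists_coeffBound
  exact Germ.coe_eq.2 h

/-! ### Initial exponents and Krull closedness of ideals -/

/-- The initial exponents of an ideal of germs, for the order of monomials by `primeSize`. -/
def initialExponents {n : ℕ} (I : Ideal (HolGerm n)) : Set (Fin n → ℕ) :=
  {α | ∃ G ∈ I, germCoeff G α = 1 ∧ ∀ β, primeSize β < primeSize α → germCoeff G β = 0}

/-- Every germ is congruent modulo an ideal to a germ none of whose exponents dominates an
initial exponent of the ideal. -/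
theorem exists_reduced_sub_mem {n : ℕ} (I : Ideal (HolGerm n)) (F : HolGerm n) :
    ∃ R : HolGerm n, F - R ∈ I ∧ ∀ α ∈ initialExponents I, germCoeff R α = 0 := by
  classical
  -- Dickson's lemma: an antichain of multi-indices is finite.
  have hfin : {α | Minimal (· ∈ initialExponents I) α}.Finite :=
    WellQuasiOrderedLE.finite_of_isAntichain (setOfPred_minimal_antichain _)
  set Γ := hfin.toFinset with hΓ
  have hmem : ∀ γ ∈ Γ, ∃ G ∈ I, germCoeff G γ = 1 ∧
      ∀ β, primeSize β < primeSize γ → germCoeff G β = 0 := fun γ hγ =>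
    (hfin.mem_toFinset.1 hγ).1
  choose! G hGI hG1 hG0 using hmem
  choose C s hb using exists_coeffBound_germCoeff (n := n)
  have hC : ∀ F, 0 ≤ C F := fun F => (hb F).nonneg
  have hsC : 0 ≤ ∑ γ ∈ Γ, C (G γ) := Finset.sum_nonneg fun γ _ => hC _
  obtain ⟨t, q, r, hq, ⟨C', hr⟩, hr0, heq⟩ := exists_division Γ (fun γ => germCoeff (G γ))
    (C := C F + ∑ γ ∈ Γ, C (G γ)) (s := s F + ∑ γ ∈ Γ, s (G γ)) hG1 hG0
    (fun γ hγ => (hb (G γ)).mono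
      ((Finset.single_le_sum (f := fun γ => C (G γ)) (fun γ _ => hC _) hγ).trans
        (le_add_of_nonneg_left (hC F)))
      ((Finset.single_le_sum (f := fun γ => s (G γ)) (fun γ _ => Nat.zero_le _) hγ).trans
        (Nat.le_add_left _ _)))
    ((hb F).mono (le_add_of_nonneg_right hsC) (Nat.le_add_right _ _))
  have hQ : ∀ γ ∈ Γ, ∃ Q : HolGerm n,
      (Q : Germ (𝓝 (0 : Fin n → ℂ)) ℂ) = (seriesEval (q γ) : (Fin n → ℂ) → ℂ) := by
    intro γ hγ
    obtain ⟨Cγ, hγb⟩ := hq γ hγ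
    exact ⟨HolGerm.mk _ hγb.analyticAt, rfl⟩
  choose! Q hQ using hQ
  refine ⟨HolGerm.mk _ hr.analyticAt, ?_, ?_⟩
  · have hF : F = ∑ γ ∈ Γ, Q γ * G γ + HolGerm.mk _ hr.analyticAt := by
      refine Subtype.ext ?_
      rw [coe_germ_eq_seriesEval F]
      push_cast
      have hev : seriesEval (germCoeff F) =ᶠ[𝓝 0]
          ((∑ γ ∈ Γ, seriesEval (q γ) * seriesEval (germCoeff (G γ)) + seriesEval r :
            (Fin n → ℂ) → ℂ)) := by
        filter_upwards [Metric.closedBall_mem_nhds (0 : Fin n → ℂ) (polyradius_pos n (t + 2))]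
          with z hz
        rw [heq z (by simpa using hz)]
        simp
      rw [Germ.coe_eq.2 hev]
      change Germ.coeRingHom (R := ℂ) (𝓝 (0 : Fin n → ℂ)) _ = _
      rw [map_add, map_sum]
      refine congrArg₂ _ (Finset.sum_congr rfl fun γ hγ => ?_) rfl
      rw [map_mul, hQ γ hγ, coe_germ_eq_seriesEval (G γ)]
      rfl
    rw [hF, add_sub_cancel_right]
    exact Ideal.sum_mem _ fun γ hγ => Ideal.mul_mem_left _ _ (hGI γ hγ)
  · intro α hα
    rw [germCoeff_mk, hr.taylorCoeff_seriesEval]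
    obtain ⟨γ, hγα, hγ⟩ := exists_minimal_le_of_wellFoundedLT (· ∈ initialExponents I) α hα
    exact hr0 α ⟨γ, hfin.mem_toFinset.2 hγ, hγα⟩

/-- Ideals of `𝒪_o` are closed in the Krull topology: a germ whose Taylor polynomials of all
degrees are Taylor polynomials of members of the ideal belongs to the ideal. -/
theorem mem_ideal_of_forall_taylor {n : ℕ} (I : Ideal (HolGerm n)) (F : HolGerm n)
    (h : ∀ k : ℕ, ∃ H ∈ I, ∀ α : Fin n → ℕ, ∑ i, α i < k → germCoeff H α = germCoeff F α) :
    F ∈ I := by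
  obtain ⟨R, hRI, hR⟩ := exists_reduced_sub_mem I F
  suffices hR0 : R = 0 by simpa [hR0] using hRI
  by_contra hne
  have hne' : {α | germCoeff R α ≠ 0}.Nonempty := by
    by_contra hempty
    refine hne (germCoeff_injective (funext fun α => ?_))
    have hz : germCoeff (0 : HolGerm n) = 0 := by
      simpa using germCoeff_sub (0 : HolGerm n) 0
    rw [hz]
    by_contra hα
    exact hempty ⟨α, hα⟩
  obtain ⟨α, hα, hmin⟩ := (measure (primeSize (n := n))).wf.has_min _ hne'
  -- Jets up to degree `primeSize α` suffice: `N(β) ≤ N(α)` forces `|β| < 2^|β| ≤ N(β) ≤ N(α)`.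
  obtain ⟨H, hHI, hH⟩ := h (primeSize α)
  have hagree : ∀ β, primeSize β ≤ primeSize α → germCoeff (H - (F - R)) β = germCoeff R β := by
    intro β hβ
    have hdeg : ∑ i, β i < primeSize α :=
      (Nat.lt_two_pow_self).trans_le ((two_pow_le_primeSize β).trans hβ)
    rw [germCoeff_sub, germCoeff_sub, Pi.sub_apply, Pi.sub_apply, hH β hdeg, sub_sub_cancel]
  -- The member `H - (F - R)` of `I` agrees with `R` up to the lowest exponent `α` of `R`. Rescaled,
  -- it makes `α` an initial exponent, where `R` must vanish.
  refine hα (hR α ⟨HolGerm.const n (germCoeff R α)⁻¹ * (H - (F - R)),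
    Ideal.mul_mem_left _ _ (I.sub_mem hHI hRI), ?_, fun β hβ => ?_⟩)
  · rw [germCoeff_const_mul, Pi.smul_apply, hagree α le_rfl, smul_eq_mul, inv_mul_cancel₀ hα]
  · rw [germCoeff_const_mul, Pi.smul_apply, hagree β hβ.le]
    have : germCoeff R β = 0 := by
      by_contra hc
      exact hmin β hc hβ
    rw [this, smul_zero]

-- Cauchy estimates and uniform limits

universe u

/-- Cauchy estimates for the iterated derivatives of a bounded analytic function. -/
theorem AnalyticOnNhd.norm_iteratedFDeriv_le {E F : Type u} [NormedAddCommGroup E]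
    [NormedSpace ℂ E] [NormedAddCommGroup F] [NormedSpace ℂ F] [CompleteSpace F] {f : E → F}
    {z : E} {R M δ : ℝ} (hf : AnalyticOnNhd ℂ f (Metric.ball z R))
    (hM : ∀ w ∈ Metric.ball z R, ‖f w‖ ≤ M) (hδ : 0 < δ) {k : ℕ} (hk : k * δ < R) :
    ‖iteratedFDeriv ℂ k f z‖ ≤ M * (2 / δ) ^ k := by
  -- Each step gives up `δ` of the radius and passes to the derivative, so the codomain changes
  -- along the induction; hence the common universe.
  induction k generalizing F R M with
  | zero =>
    rw [norm_iteratedFDeriv_zero, pow_zero, mul_one]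
    exact hM z (Metric.mem_ball_self (by simpa using hk))
  | succ k ih =>
    rw [← norm_iteratedFDeriv_fderiv]
    push_cast at hk
    have hsub : Metric.ball z (R - δ) ⊆ Metric.ball z R := Metric.ball_subset_ball (by linarith)
    refine (ih (M := 2 * M / δ) (R := R - δ) (fun w hw => (hf w (hsub hw)).fderiv) ?_
      (by linarith)).trans (le_of_eq ?_)
    · intro w hw
      have hball : Metric.ball w δ ⊆ Metric.ball z R := by
        refine Metric.ball_subset_ball' ?_
        rw [Metric.mem_ball] at hw
        linarith
      -- The values stay within `2 * M` of `f w`, which is the origin of the factor 2.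
      refine Complex.norm_fderiv_le_div_of_mapsTo_ball
        (fun y hy => (hf y (hball hy)).differentiableAt.differentiableWithinAt) ?_ hδ
      intro y hy
      rw [Metric.mem_closedBall, dist_eq_norm]
      refine (norm_sub_le _ _).trans ?_
      have h1 := hM y (hball hy)
      have h2 := hM w (hsub hw)
      linarith
    · rw [pow_succ]
      ring

theorem le_radius_of_cauchy {E F : Type*} [NormedAddCommGroup E] [NormedSpace ℂ E]
    [NormedAddCommGroup F] [NormedSpace ℂ F] {p : FormalMultilinearSeries ℂ E F} {ρ C : ℝ} (hρ : 0 < ρ)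
    (h : ∀ k, ‖p k‖ * ρ ^ k ≤ C) : ENNReal.ofReal ρ ≤ p.radius := by
  refine p.le_radius_of_bound C fun k => ?_
  rw [Real.coe_toNNReal _ hρ.le]
  exact h k

section TaylorSeries

variable {E F : Type u} [NormedAddCommGroup E] [NormedSpace ℂ E] [NormedAddCommGroup F]
  [NormedSpace ℂ F] [CompleteSpace F]

/-- The Taylor series `∑ D^k f(z) / k!` of `f` at `z`. -/
noncomputable def cauchyTaylorSeries (f : E → F) (z : E) : FormalMultilinearSeries ℂ E F :=
  fun k => ((k.factorial : ℂ))⁻¹ • iteratedFDeriv ℂ k f z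

/-- The radius on which the Taylor series of a function bounded on a ball of radius `R` is
controlled by the Cauchy estimates. -/
noncomputable def cauchyRadius (R : ℝ) : ℝ := R / (2 * Real.exp 1)

theorem cauchyRadius_pos {R : ℝ} (hR : 0 < R) : 0 < cauchyRadius R := by
  unfold cauchyRadius
  positivity

theorem cauchyRadius_le {R : ℝ} (hR : 0 < R) : cauchyRadius R ≤ R := by
  refine div_le_self hR.le ?_
  have := Real.add_one_le_exp 1
  linarith

/-- Steps of length `R / (k + 1)` cost `(k + 1) ^ k`, which `k!` absorbs up to `e ^ (k + 1)`. The
factor `2 e` in `cauchyRadius` removes the geometric part and leaves one `e`. -/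
theorem AnalyticOnNhd.norm_taylor_le {f : E → F} {z : E} {R M : ℝ} (hR : 0 < R)
    (hf : AnalyticOnNhd ℂ f (Metric.ball z R)) (hM : ∀ w ∈ Metric.ball z R, ‖f w‖ ≤ M) (k : ℕ) :
    ‖cauchyTaylorSeries f z k‖ * cauchyRadius R ^ k ≤ M * Real.exp 1 := by
  have hM0 : 0 ≤ M := (norm_nonneg _).trans (hM z (Metric.mem_ball_self hR))
  have hδ : 0 < R / (k + 1) := by positivity
  have h1 := hf.norm_iteratedFDeriv_le hM hδ (k := k) (by
    rw [mul_div_assoc', div_lt_iff₀ (by positivity)]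
    linarith)
  have h2 := Real.pow_div_factorial_le_exp _ (show (0 : ℝ) ≤ k + 1 by positivity) k
  rw [cauchyTaylorSeries, norm_smul, norm_inv, Complex.norm_natCast]
  have hfac : (0 : ℝ) < k.factorial := Nat.cast_pos.2 k.factorial_pos
  have he : Real.exp (k + 1) = Real.exp 1 ^ k * Real.exp 1 := by
    rw [Real.exp_add, ← Real.exp_nat_mul, mul_one]
  have hρ := cauchyRadius_pos hR
  calc ((k.factorial : ℝ)⁻¹ * ‖iteratedFDeriv ℂ k f z‖) * cauchyRadius R ^ k
      ≤ ((k.factorial : ℝ)⁻¹ * (M * (2 / (R / (k + 1))) ^ k)) * cauchyRadius R ^ k := by gcongr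
    _ = M * (((k : ℝ) + 1) ^ k / k.factorial) / Real.exp 1 ^ k := by
        unfold cauchyRadius
        rw [div_div_eq_mul_div, div_pow, div_pow, mul_pow, mul_pow]
        have : R ^ k ≠ 0 := by positivity
        field_simp
    _ ≤ M * Real.exp (k + 1) / Real.exp 1 ^ k := by gcongr
    _ = M * Real.exp 1 := by
        rw [he]
        field_simp

/-- The Taylor series of a bounded analytic function converges to it on a ball of controlled
radius. -/
theorem AnalyticOnNhd.hasFPowerSeriesOnBall_taylor {f : E → F} {z : E} {R M : ℝ} (hR : 0 < R)
    (hf : AnalyticOnNhd ℂ f (Metric.ball z R)) (hM : ∀ w ∈ Metric.ball z R, ‖f w‖ ≤ M) :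
    HasFPowerSeriesOnBall f (cauchyTaylorSeries f z) z (ENNReal.ofReal (cauchyRadius R)) := by
  set p := cauchyTaylorSeries f z with hp
  have hρ := cauchyRadius_pos hR
  have hrad : ENNReal.ofReal (cauchyRadius R) ≤ p.radius :=
    le_radius_of_cauchy hρ (hf.norm_taylor_le hR hM)
  have hrad0 : 0 < p.radius := (ENNReal.ofReal_pos.2 hρ).trans_le hrad
  have hsum := p.hasFPowerSeriesOnBall hrad0
  have hball : Metric.ball (0 : E) (cauchyRadius R) ⊆ Metric.eball 0 p.radius := by
    rw [← Metric.eball_ofReal]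
    exact Metric.eball_subset_eball hrad
  -- Identity theorem: both sides are analytic on a convex ball and agree near its centre.
  have heq : EqOn (fun y => f (z + y)) p.sum (Metric.ball 0 (cauchyRadius R)) := by
    refine AnalyticOnNhd.eqOn_of_preconnected_of_eventuallyEq (𝕜 := ℂ) (z₀ := 0) ?_
      (hsum.analyticOnNhd.mono hball) (convex_ball _ _).isPreconnected
      (Metric.mem_ball_self hρ) ?_
    · intro y hy
      have hzy : z + y ∈ Metric.ball z R := by
        have := (mem_ball_zero_iff.1 hy).trans_le (cauchyRadius_le hR)
        simpa [Metric.mem_ball, dist_eq_norm] using this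
      exact (hf _ hzy).fun_comp (analyticAt_const.add analyticAt_id)
    · obtain ⟨q, r, hq⟩ := hf z (Metric.mem_ball_self hR)
      filter_upwards [Metric.eball_mem_nhds (0 : E) hq.r_pos] with y hy
      exact (hq.hasSum_iteratedFDeriv hy).tsum_eq.symm
  refine ⟨hrad, ENNReal.ofReal_pos.2 hρ, fun {y} hy => ?_⟩
  have hy' : y ∈ Metric.ball (0 : E) (cauchyRadius R) := by rwa [← Metric.eball_ofReal]
  rw [show f (z + y) = p.sum y from heq hy']
  exact p.hasSum (hball hy')

theorem taylor_sub {f g : E → F} {z : E} (hf : AnalyticAt ℂ f z) (hg : AnalyticAt ℂ g z) (k : ℕ) :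
    cauchyTaylorSeries (f - g) z k
      = cauchyTaylorSeries f z k - cauchyTaylorSeries g z k := by
  rw [cauchyTaylorSeries, cauchyTaylorSeries, cauchyTaylorSeries,
    iteratedFDeriv_sub_apply hf.contDiffAt hg.contDiffAt, smul_sub]

/-- A uniform limit of uniformly bounded analytic functions is analytic. -/
theorem analyticAt_of_tendstoUniformlyOn {f : ℕ → E → F} {g : E → F} {z : E} {R M : ℝ}
    (hR : 0 < R) (hf : ∀ j, AnalyticOnNhd ℂ (f j) (Metric.ball z R))
    (hM : ∀ j, ∀ w ∈ Metric.ball z R, ‖f j w‖ ≤ M)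
    (hlim : TendstoUniformlyOn f g atTop (Metric.ball z R)) : AnalyticAt ℂ g z := by
  have hρ := cauchyRadius_pos hR
  have hz : z ∈ Metric.ball z R := Metric.mem_ball_self hR
  have hcauchy : ∀ k, CauchySeq fun j => cauchyTaylorSeries (f j) z k := by
    intro k
    rw [Metric.cauchySeq_iff]
    intro ε hε
    -- Chosen so that the Cauchy bound `η * e` for a difference is `ε / 2` times `cauchyRadius R ^
    -- k`.
    set η := ε * cauchyRadius R ^ k / (2 * Real.exp 1) with hη
    have hη0 : 0 < η := by positivity
    have hu := Metric.uniformCauchySeqOn_iff.1 hlim.uniformCauchySeqOn η hη0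
    obtain ⟨N, hN⟩ := hu
    refine ⟨N, fun i hi j hj => ?_⟩
    rw [dist_eq_norm, ← taylor_sub (hf i z hz) (hf j z hz)]
    have h1 := ((hf i).sub (hf j)).norm_taylor_le hR (M := η) (fun w hw => by
      rw [Pi.sub_apply, ← dist_eq_norm]
      exact (hN i hi j hj w hw).le) k
    have h2 : η * Real.exp 1 = ε / 2 * cauchyRadius R ^ k := by
      rw [hη]
      field_simp
    rw [h2] at h1
    have h3 := le_of_mul_le_mul_right h1 (by positivity)
    linarith
  choose q hq using fun k => cauchySeq_tendsto_of_complete (hcauchy k)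
  have hqb : ∀ k, ‖q k‖ * cauchyRadius R ^ k ≤ M * Real.exp 1 := fun k =>
    le_of_tendsto ((hq k).norm.mul_const _)
      (Eventually.of_forall fun j => (hf j).norm_taylor_le hR (hM j) k)
  have hseries : HasFPowerSeriesOnBall g q z (ENNReal.ofReal (cauchyRadius R)) := by
    have hrad : ENNReal.ofReal (cauchyRadius R) ≤ FormalMultilinearSeries.radius q :=
      le_radius_of_cauchy hρ hqb
    refine ⟨hrad, ENNReal.ofReal_pos.2 hρ, fun {y} hy => ?_⟩
    have hyn : ‖y‖ < cauchyRadius R := by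
      rw [Metric.eball_ofReal] at hy
      exact mem_ball_zero_iff.1 hy
    have hzy : z + y ∈ Metric.ball z R := by
      simpa [Metric.mem_ball, dist_eq_norm] using hyn.trans_le (cauchyRadius_le hR)
    have hdom : Tendsto (fun j => ∑' k, cauchyTaylorSeries (f j) z k fun _ => y) atTop
        (𝓝 (∑' k, q k fun _ => y)) := by
      refine tendsto_tsum_of_dominated_convergence
        (bound := fun k => M * Real.exp 1 * (‖y‖ / cauchyRadius R) ^ k) ?_ ?_ ?_
      · exact (summable_geometric_of_lt_one (by positivity) ((div_lt_one hρ).2 hyn)).mul_left _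
      · intro k
        exact ((ContinuousMultilinearMap.apply ℂ (fun _ : Fin k => E) F
          fun _ => y).continuous.tendsto _).comp (hq k)
      · refine Eventually.of_forall fun j k => ?_
        refine (ContinuousMultilinearMap.le_opNorm _ _).trans ?_
        rw [Finset.prod_const, Finset.card_univ, Fintype.card_fin, div_pow, mul_div_assoc',
          le_div_iff₀ (by positivity), mul_right_comm]
        exact mul_le_mul_of_nonneg_right ((hf j).norm_taylor_le hR (hM j) k) (by positivity)
    have hval : ∀ j, (∑' k, cauchyTaylorSeries (f j) z k fun _ => y) = f j (z + y) := fun j =>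
      (((hf j).hasFPowerSeriesOnBall_taylor hR (hM j)).hasSum hy).tsum_eq
    simp only [hval] at hdom
    rw [tendsto_nhds_unique (hlim.tendsto_at hzy) hdom]
    exact FormalMultilinearSeries.hasSum q (Metric.eball_subset_eball hrad hy)
  exact hseries.analyticAt

end TaylorSeries

/-! ### Mean value inequality and local bounds -/

theorem measurePreserving_smul_of_norm_eq_one {n : ℕ} {c : ℂ} (hc : ‖c‖ = 1) :
    MeasurePreserving (fun w : Fin n → ℂ => c • w) := by
  have h1 : MeasurePreserving (fun w : ℂ => c * w) := by
    have := (rotation (⟨c, mem_sphere_zero_iff_norm.2 hc⟩ : Circle)).measurePreserving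
    exact this
  exact volume_preserving_pi fun _ => h1

/-- The function `ζ ↦ f (z + ζ w) ^ 2` is holomorphic near the closed unit disc, so its value at 0
is its circle average; then take absolute values. -/
theorem enorm_sq_le_lintegral_circle {n : ℕ} {f : (Fin n → ℂ) → ℂ} {z w : Fin n → ℂ} {r : ℝ}
    (hf : AnalyticOnNhd ℂ f (Metric.ball z r)) (hw : w ∈ Metric.ball 0 r) :
    ENNReal.ofReal (2 * Real.pi) * ‖f z‖ₑ ^ 2 ≤
      ∫⁻ θ in Ioc 0 (2 * Real.pi), ‖f (z + circleMap 0 1 θ • w)‖ₑ ^ 2 := by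
  set h : ℂ → ℂ := fun ζ => f (z + ζ • w) ^ 2 with hh
  have hdiff : ∀ ζ ∈ Metric.closedBall (0 : ℂ) 1, DifferentiableAt ℂ h ζ := by
    intro ζ hζ
    have hmem : z + ζ • w ∈ Metric.ball z r := by
      rw [Metric.mem_ball, dist_eq_norm, add_sub_cancel_left, norm_smul]
      have h1 : ‖ζ‖ ≤ 1 := by simpa using hζ
      have h2 : ‖w‖ < r := by simpa using hw
      nlinarith [norm_nonneg w]
    have h3 : DifferentiableAt ℂ (fun ζ : ℂ => z + ζ • w) ζ := by fun_prop
    exact ((hf _ hmem).differentiableAt.comp ζ h3).pow 2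
  have hcl : DiffContOnCl ℂ h (Metric.ball 0 |1|) := by
    rw [abs_one]
    refine DifferentiableOn.diffContOnCl ?_
    rw [closure_ball _ one_ne_zero]
    exact fun ζ hζ => (hdiff ζ hζ).differentiableWithinAt
  have havg := hcl.circleAverage
  have hpi : 0 < 2 * Real.pi := Real.two_pi_pos
  have hz : h 0 = f z ^ 2 := by simp [hh]
  rw [Real.circleAverage, hz, inv_smul_eq_iff₀ hpi.ne', intervalIntegral.integral_of_le hpi.le]
    at havg
  have hnorm := enorm_integral_le_lintegral_enorm (μ := volume.restrict (Ioc 0 (2 * Real.pi)))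
    (fun θ => h (circleMap 0 1 θ))
  rw [havg, enorm_smul, enorm_pow, Real.enorm_of_nonneg hpi.le] at hnorm
  refine hnorm.trans (le_of_eq (lintegral_congr fun θ => ?_))
  rw [hh, enorm_pow]

/-- The sub-mean value inequality for `|f|²` on polydiscs. -/
theorem volume_mul_enorm_sq_le_lintegral {n : ℕ} {f : (Fin n → ℂ) → ℂ} {z : Fin n → ℂ} {r : ℝ}
    (hf : AnalyticOnNhd ℂ f (Metric.ball z r)) :
    volume (Metric.ball (0 : Fin n → ℂ) r) * ‖f z‖ₑ ^ 2 ≤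
      ∫⁻ w in Metric.ball z r, ‖f w‖ₑ ^ 2 := by
  classical
  -- Extension by zero provides the global measurability needed for Tonelli.
  set g : (Fin n → ℂ) → ℂ := (Metric.ball z r).piecewise f 0 with hg
  have hgm : Measurable g :=
    ContinuousOn.measurable_piecewise hf.continuousOn continuousOn_const measurableSet_ball
  have hgf : ∀ w ∈ Metric.ball z r, g w = f w := fun w hw => piecewise_eq_of_mem _ _ _ hw
  have hmem : ∀ w ∈ Metric.ball (0 : Fin n → ℂ) r, ∀ θ : ℝ,
      z + circleMap 0 1 θ • w ∈ Metric.ball z r := by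
    intro w hw θ
    rw [Metric.mem_ball, dist_eq_norm, add_sub_cancel_left, norm_smul, norm_circleMap_zero,
      abs_one, one_mul]
    simpa using hw
  -- A simultaneous rotation of all coordinates preserves the polydisc and its volume, so the inner
  -- integral does not depend on `θ`.
  have hinner : ∀ θ : ℝ, ∫⁻ w in Metric.ball (0 : Fin n → ℂ) r,
      ‖g (z + circleMap 0 1 θ • w)‖ₑ ^ 2 = ∫⁻ w in Metric.ball z r, ‖f w‖ₑ ^ 2 := by
    intro θ
    have hc : ‖circleMap 0 1 θ‖ = 1 := by simp
    have hmp : MeasurePreserving (fun w : Fin n → ℂ => z + circleMap 0 1 θ • w) :=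
      (measurePreserving_add_left volume z).comp (measurePreserving_smul_of_norm_eq_one hc)
    have hpre : (fun w : Fin n → ℂ => z + circleMap 0 1 θ • w) ⁻¹' Metric.ball z r
        = Metric.ball 0 r := by
      ext w
      simp [Metric.mem_ball, dist_eq_norm, norm_smul]
    have h1 := hmp.setLIntegral_comp_preimage (s := Metric.ball z r) measurableSet_ball
      (f := fun w => ‖g w‖ₑ ^ 2) (by fun_prop)
    rw [hpre] at h1
    rw [h1]
    exact setLIntegral_congr_fun measurableSet_ball fun w hw => by simp only [hgf w hw]
  have hpi : 0 < 2 * Real.pi := Real.two_pi_pos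
  have hmain : ∫⁻ w in Metric.ball (0 : Fin n → ℂ) r, ENNReal.ofReal (2 * Real.pi) * ‖f z‖ₑ ^ 2 ≤
      ∫⁻ w in Metric.ball (0 : Fin n → ℂ) r, ∫⁻ θ in Ioc 0 (2 * Real.pi),
        ‖g (z + circleMap 0 1 θ • w)‖ₑ ^ 2 := by
    refine setLIntegral_mono' measurableSet_ball fun w hw => ?_
    refine (enorm_sq_le_lintegral_circle hf hw).trans (le_of_eq ?_)
    exact lintegral_congr fun θ => by rw [hgf _ (hmem w hw θ)]
  rw [lintegral_lintegral_swap] at hmain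
  · simp only [hinner] at hmain
    rw [setLIntegral_const, setLIntegral_const, Real.volume_Ioc, sub_zero, mul_assoc,
      mul_comm _ (ENNReal.ofReal _), mul_comm (‖f z‖ₑ ^ 2)] at hmain
    exact (ENNReal.mul_le_mul_iff_right (ENNReal.ofReal_pos.2 hpi).ne' ENNReal.ofReal_ne_top).1 hmain
  · refine Measurable.aemeasurable ?_
    have hc : Measurable fun p : (Fin n → ℂ) × ℝ => z + circleMap 0 1 p.2 • p.1 := by
      have : Continuous fun p : (Fin n → ℂ) × ℝ => z + circleMap 0 1 p.2 • p.1 := by fun_prop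
      exact this.measurable
    exact ((hgm.comp hc).enorm).pow_const 2

/-- Local uniform bounds for holomorphic functions in terms of the weighted norm. -/
theorem exists_local_bound {n : ℕ} {D : Set (Fin n → ℂ)} (hD : IsOpen D)
    {ψ : (Fin n → ℂ) → EReal} (hψ : IsPSH ψ D) {z : Fin n → ℂ} (hz : z ∈ D) :
    ∃ r > 0, ∃ C : ℝ≥0∞, C ≠ ⊤ ∧ Metric.ball z r ⊆ D ∧ ∀ f : (Fin n → ℂ) → ℂ,
      AnalyticOnNhd ℂ f D → ∀ w ∈ Metric.ball z r, ‖f w‖ₑ ^ 2 ≤ C * weightedNormSq D ψ f := by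
  obtain ⟨M, hM, -⟩ := EReal.lt_iff_exists_real_btwn.1 (lt_top_iff_ne_top.2 (hψ.ne_top z hz))
  have h1 : ∀ᶠ w in 𝓝 z, ψ w < M := by
    have := hψ.usc z hz M hM
    rwa [hD.nhdsWithin_eq hz] at this
  obtain ⟨ρ, hρ, hρsub⟩ := Metric.mem_nhds_iff.1 (h1.and (hD.mem_nhds hz))
  -- Halving keeps the ball of radius `r` about each `w` inside the region where `ψ < M`, so `e^{-ψ}
  -- ≥ e^{-M}` there.
  set r := ρ / 2 with hr
  have hr0 : 0 < r := by positivity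
  set V := volume (Metric.ball (0 : Fin n → ℂ) r) with hV
  have hV0 : V ≠ 0 := (Metric.measure_ball_pos volume _ hr0).ne'
  have hVt : V ≠ ⊤ := measure_ball_lt_top.ne
  set e := EReal.exp (M : EReal) with he
  have het : e ≠ ⊤ := by simp [he]
  refine ⟨r, hr0, V⁻¹ * e, ENNReal.mul_ne_top (ENNReal.inv_ne_top.2 hV0) het, fun w hw =>
    (hρsub (Metric.ball_subset_ball (by linarith) hw)).2, fun f hf w hw => ?_⟩
  have hsub : Metric.ball w r ⊆ Metric.ball z ρ := by
    refine Metric.ball_subset_ball' ?_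
    have := Metric.mem_ball.1 hw
    linarith
  have hmean := volume_mul_enorm_sq_le_lintegral (f := f) (z := w) (r := r)
    (fun y hy => hf y (hρsub (hsub hy)).2)
  have hweight : ∫⁻ y in Metric.ball w r, ‖f y‖ₑ ^ 2 ≤ e * weightedNormSq D ψ f := by
    calc ∫⁻ y in Metric.ball w r, ‖f y‖ₑ ^ 2
        ≤ ∫⁻ y in Metric.ball w r, e * (‖f y‖ₑ ^ 2 * EReal.exp (-ψ y)) := by
          refine setLIntegral_mono' measurableSet_ball fun y hy => ?_
          have h2 : 1 ≤ e * EReal.exp (-ψ y) := by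
            have h3 : EReal.exp (-(M : EReal)) ≤ EReal.exp (-ψ y) :=
              EReal.exp_monotone (EReal.neg_le_neg_iff.2 (hρsub (hsub hy)).1.le)
            refine le_trans (le_of_eq ?_) (mul_le_mul_right h3 e)
            rw [he, ← EReal.coe_neg, EReal.exp_coe, EReal.exp_coe, ← ENNReal.ofReal_mul
              (Real.exp_pos _).le, ← Real.exp_add, add_neg_cancel, Real.exp_zero,
              ENNReal.ofReal_one]
          rw [mul_left_comm]
          exact le_mul_of_one_le_right zero_le h2
      _ = e * ∫⁻ y in Metric.ball w r, ‖f y‖ₑ ^ 2 * EReal.exp (-ψ y) :=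
          lintegral_const_mul' _ _ het
      _ ≤ e * weightedNormSq D ψ f :=
          mul_le_mul_right (lintegral_mono_set fun y hy => (hρsub (hsub hy)).2) _
  have h4 := hmean.trans hweight
  rw [mul_assoc, ← ENNReal.mul_le_iff_le_inv hV0 hVt]
  exact h4

/-- A sequence of holomorphic functions that is Cauchy in the weighted norm converges pointwise
to a holomorphic function. -/
theorem exists_holomorphic_limit {n : ℕ} {D : Set (Fin n → ℂ)} (hD : IsOpen D)
    {ψ : (Fin n → ℂ) → EReal} (hψ : IsPSH ψ D) {f : ℕ → (Fin n → ℂ) → ℂ}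
    (hf : ∀ j, AnalyticOnNhd ℂ (f j) D) (hfin : ∀ j, weightedNormSq D ψ (f j) ≠ ⊤)
    (hcauchy : ∀ ε : ℝ≥0∞, 0 < ε → ∃ N, ∀ i ≥ N, ∀ j ≥ N, weightedNormSq D ψ (f i - f j) < ε) :
    ∃ g : (Fin n → ℂ) → ℂ, AnalyticOnNhd ℂ g D ∧
      ∀ z ∈ D, Tendsto (fun j => f j z) atTop (𝓝 (g z)) := by
  have hloc : ∀ z ∈ D, ∃ r > 0, Metric.ball z r ⊆ D ∧
      UniformCauchySeqOn f atTop (Metric.ball z r) ∧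
      ∀ j, ∃ M : ℝ, ∀ w ∈ Metric.ball z r, ‖f j w‖ ≤ M := by
    intro z hz
    obtain ⟨r, hr, C, hC, hsub, hb⟩ := exists_local_bound hD hψ hz
    refine ⟨r, hr, hsub, Metric.uniformCauchySeqOn_iff.2 fun ε hε => ?_, fun j => ?_⟩
    · have hε2 : 0 < ENNReal.ofReal ε ^ 2 := by
        have := ENNReal.ofReal_pos.2 hε
        positivity
      obtain ⟨N, hN⟩ := hcauchy (ENNReal.ofReal ε ^ 2 / (C + 1))
        (ENNReal.div_pos hε2.ne' (by simp [hC]))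
      refine ⟨N, fun i hi j hj w hw => ?_⟩
      have h1 := hb (f i - f j) ((hf i).sub (hf j)) w hw
      have h2 : C * weightedNormSq D ψ (f i - f j) < ENNReal.ofReal ε ^ 2 := by
        have h3 := hN i hi j hj
        rw [ENNReal.lt_div_iff_mul_lt (by simp) (by simp [hC])] at h3
        refine lt_of_le_of_lt ?_ h3
        rw [mul_comm]
        exact mul_le_mul_right le_self_add _
      have h4 := lt_of_pow_lt_pow_left' 2 (h1.trans_lt h2)
      rw [Pi.sub_apply, ← edist_eq_enorm_sub, edist_dist, ENNReal.ofReal_lt_ofReal_iff hε] at h4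
      exact h4
    · have hfin' : C * weightedNormSq D ψ (f j) ≠ ⊤ := ENNReal.mul_ne_top hC (hfin j)
      refine ⟨(C * weightedNormSq D ψ (f j)).toReal + 1, fun w hw => ?_⟩
      have h1 := ENNReal.toReal_mono hfin' (hb (f j) (hf j) w hw)
      rw [ENNReal.toReal_pow, toReal_enorm] at h1
      nlinarith [sq_nonneg (‖f j w‖ - 1)]
  have hlim : ∀ z ∈ D, ∃ l, Tendsto (fun j => f j z) atTop (𝓝 l) := by
    intro z hz
    obtain ⟨r, hr, -, hu, -⟩ := hloc z hz
    exact cauchySeq_tendsto_of_complete (hu.cauchySeq (Metric.mem_ball_self hr))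
  choose! g hg using hlim
  refine ⟨g, fun z hz => ?_, hg⟩
  obtain ⟨r, hr, hsub, hu, hM⟩ := hloc z hz
  have htend : TendstoUniformlyOn f g atTop (Metric.ball z r) :=
    hu.tendstoUniformlyOn_of_tendsto fun w hw => hg w (hsub hw)
  obtain ⟨N, hN⟩ := Metric.uniformCauchySeqOn_iff.1 hu 1 one_pos
  obtain ⟨M, hMN⟩ := hM N
  -- Dropping the first `N` terms leaves functions within 1 of `f N`, hence the common bound `M +
  -- 1`.
  refine analyticAt_of_tendstoUniformlyOn (f := fun j => f (j + N)) (M := M + 1) hr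
    (fun j w hw => hf _ w (hsub hw)) (fun j w hw => ?_) ?_
  · have h1 := hN (j + N) (Nat.le_add_left _ _) N le_rfl w hw
    rw [dist_eq_norm] at h1
    have h2 := norm_sub_norm_le (f (j + N) w) (f N w)
    have h3 := hMN w hw
    linarith
  · intro u hu'
    exact (tendsto_add_atTop_nat N).eventually (htend u hu')

/-! ### Representation of functionals on a Hilbert space -/

/-- A functional bounded by the norms of a linear family of continuous functionals on a Hilbert
space is represented by a vector of the corresponding norm. -/
theorem exists_norm_le_of_functional_bound {E V : Type*} [NormedAddCommGroup E]
    [InnerProductSpace ℂ E] [CompleteSpace E] [AddCommGroup V] [Module ℂ V]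
    (B : V →ₗ[ℂ] (E →L[ℂ] ℂ)) (φ : V →ₗ[ℂ] ℂ) {c : ℝ} (hc : 0 ≤ c)
    (h : ∀ v K, 0 ≤ K → (∀ x, ‖B v x‖ ≤ K * ‖x‖) → ‖φ v‖ ≤ c * K) : ∃ x : E, ‖x‖ ≤ c ∧ ∀ v, B v x = φ v := by
  replace h : ∀ v, ‖φ v‖ ≤ c * ‖B v‖ := fun v => h v _ (norm_nonneg _) (B v).le_opNorm
  -- The bound lets `φ` factor through the range of `B`, where Hahn-Banach applies.
  have hwd : ∀ v w, B v = B w → φ v = φ w := by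
    intro v w hvw
    have h1 := h (v - w)
    rw [map_sub, map_sub, hvw, sub_self, norm_zero, mul_zero] at h1
    exact sub_eq_zero.1 (norm_le_zero_iff.1 h1)
  let W : Submodule ℂ (E →L[ℂ] ℂ) := LinearMap.range B
  have hW : ∀ w : W, ∃ v, B v = w := fun w => w.2
  choose s hs using hW
  let φ₀ : W →L[ℂ] ℂ := LinearMap.mkContinuous
    { toFun := fun w => φ (s w)
      map_add' := fun v w => by
        rw [← map_add]
        refine hwd _ _ ?_
        rw [map_add, hs, hs, hs]
        rfl
      map_smul' := fun a v => by
        rw [RingHom.id_apply, ← map_smul]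
        refine hwd _ _ ?_
        rw [map_smul, hs, hs]
        rfl } c fun w => by
      refine (h (s w)).trans_eq ?_
      rw [hs]
      rfl
  obtain ⟨Φ, hΦ, hΦn⟩ := exists_extension_norm_eq W φ₀
  have hΦc : ‖Φ‖ ≤ c := hΦn.trans_le (LinearMap.mkContinuous_norm_le _ hc _)
  -- Reflexivity: the Riesz map is conjugate-linear, so conjugating `Φ` after it gives a linear
  -- functional, whose Riesz vector represents `Φ` as evaluation.
  let ψ : StrongDual ℂ E := LinearMap.mkContinuous
    { toFun := fun y => starRingEnd ℂ (Φ (InnerProductSpace.toDual ℂ E y))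
      map_add' := fun y z => by simp
      map_smul' := fun a y => by
        rw [LinearIsometryEquiv.map_smulₛₗ, ContinuousLinearMap.map_smul, smul_eq_mul, map_mul,
          Complex.conj_conj]
        rfl } c fun y => by
      refine (RCLike.norm_conj _).trans_le ((Φ.le_opNorm _).trans ?_)
      rw [LinearIsometryEquiv.norm_map]
      exact mul_le_mul_of_nonneg_right hΦc (norm_nonneg _)
  refine ⟨(InnerProductSpace.toDual ℂ E).symm ψ, ?_, fun v => ?_⟩
  · rw [LinearIsometryEquiv.norm_map]
    exact LinearMap.mkContinuous_norm_le _ hc _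
  · obtain ⟨y, hy⟩ := (InnerProductSpace.toDual ℂ E).surjective (B v)
    rw [← hy, InnerProductSpace.toDual_apply_apply, ← inner_conj_symm,
      InnerProductSpace.toDual_symm_apply]
    change starRingEnd ℂ (starRingEnd ℂ (Φ (InnerProductSpace.toDual ℂ E y))) = _
    rw [Complex.conj_conj, hy]
    refine (hΦ ⟨B v, v, rfl⟩).trans ?_
    exact hwd _ _ (hs _)

/-! ### The weighted Bergman space as a Hilbert space -/

section BergmanSpace

variable {n : ℕ} {D : Set (Fin n → ℂ)} {ψ : (Fin n → ℂ) → EReal}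

/-- The measure `e^{-ψ} dV` on `D`. -/
noncomputable def weightedMeasure (D : Set (Fin n → ℂ)) (ψ : (Fin n → ℂ) → EReal) :
    Measure (Fin n → ℂ) :=
  (volume.restrict D).withDensity fun z => EReal.exp (-ψ z)

theorem aemeasurable_weight (hD : IsOpen D) (hψ : IsPSH ψ D) :
    AEMeasurable (fun z => EReal.exp (-ψ z)) (volume.restrict D) := by
  refine aemeasurable_restrict_of_measurable_subtype hD.measurableSet ?_
  have h1 : UpperSemicontinuous fun x : D => ψ x := upperSemicontinuousOn_iff_restrict.2 hψ.usc
  exact EReal.measurable_exp.comp (measurable_neg.comp h1.measurable)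

theorem ae_mem_of_weightedMeasure (hD : IsOpen D) : ∀ᵐ z ∂weightedMeasure D ψ, z ∈ D :=
  (withDensity_absolutelyContinuous _ _).ae_le (ae_restrict_mem hD.measurableSet)

theorem AnalyticOnNhd.aestronglyMeasurable_weighted (hD : IsOpen D) {f : (Fin n → ℂ) → ℂ}
    (hf : AnalyticOnNhd ℂ f D) : AEStronglyMeasurable f (weightedMeasure D ψ) :=
  (hf.continuousOn.aestronglyMeasurable hD.measurableSet).mono_ac
    (withDensity_absolutelyContinuous _ _)

theorem eLpNorm_sq_eq_weightedNormSq (hD : IsOpen D) (hψ : IsPSH ψ D) {f : (Fin n → ℂ) → ℂ}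
    (hf : AnalyticOnNhd ℂ f D) :
    eLpNorm f 2 (weightedMeasure D ψ) ^ 2 = weightedNormSq D ψ f := by
  rw [eLpNorm_eq_lintegral_rpow_enorm_toReal two_ne_zero ENNReal.ofNat_ne_top]
  rw [← ENNReal.rpow_natCast, ← ENNReal.rpow_mul]
  simp only [ENNReal.toReal_ofNat, Nat.cast_ofNat, ENNReal.rpow_ofNat]
  rw [one_div, inv_mul_cancel₀ two_ne_zero, ENNReal.rpow_one, weightedMeasure,
    lintegral_withDensity_eq_lintegral_mul₀ (aemeasurable_weight hD hψ), weightedNormSq]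
  · exact lintegral_congr fun z => mul_comm _ _
  · exact ((hf.continuousOn.aestronglyMeasurable hD.measurableSet).enorm).pow_const 2

theorem enorm_sq_eq_weightedNormSq (hD : IsOpen D) (hψ : IsPSH ψ D) {f : (Fin n → ℂ) → ℂ}
    (hf : AnalyticOnNhd ℂ f D) {u : Lp ℂ 2 (weightedMeasure D ψ)}
    (hu : u =ᵐ[weightedMeasure D ψ] f) : ‖u‖ₑ ^ 2 = weightedNormSq D ψ f := by
  rw [← eLpNorm_sq_eq_weightedNormSq hD hψ hf, ← eLpNorm_congr_ae hu, Lp.enorm_def]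

/-- The weighted Bergman space as a subspace of `L²(e^{-ψ} dV)`. -/
def bergmanSubmodule (D : Set (Fin n → ℂ)) (ψ : (Fin n → ℂ) → EReal) :
    Submodule ℂ (Lp ℂ 2 (weightedMeasure D ψ)) where
  carrier := {u | ∃ f, AnalyticOnNhd ℂ f D ∧ u =ᵐ[weightedMeasure D ψ] f}
  add_mem' := by
    rintro u v ⟨f, hf, hu⟩ ⟨g, hg, hv⟩
    exact ⟨f + g, hf.add hg, (Lp.coeFn_add u v).trans (hu.add hv)⟩
  zero_mem' := ⟨0, analyticOnNhd_const, Lp.coeFn_zero _ _ _⟩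
  smul_mem' := by
    rintro c u ⟨f, hf, hu⟩
    exact ⟨c • f, hf.const_smul, (Lp.coeFn_smul c u).trans (hu.const_smul c)⟩

/-- An `L²` limit of holomorphic functions has a holomorphic pointwise limit on `D`; an a.e.
convergent subsequence identifies the two. -/
theorem isClosed_bergmanSubmodule (hD : IsOpen D) (hψ : IsPSH ψ D) :
    IsClosed (bergmanSubmodule D ψ : Set (Lp ℂ 2 (weightedMeasure D ψ))) := by
  refine IsSeqClosed.isClosed fun u v hu huv => ?_
  choose f hf hfu using hu
  have hsub : ∀ i j, weightedNormSq D ψ (f i - f j) = ‖u i - u j‖ₑ ^ 2 := fun i j =>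
    (enorm_sq_eq_weightedNormSq hD hψ ((hf i).sub (hf j))
      ((Lp.coeFn_sub _ _).trans ((hfu i).sub (hfu j)))).symm
  obtain ⟨g, hg, hlim⟩ := exists_holomorphic_limit hD hψ hf
    (fun j => by
      rw [← enorm_sq_eq_weightedNormSq hD hψ (hf j) (hfu j)]
      exact ENNReal.pow_ne_top enorm_ne_top)
    (fun ε hε => by
      -- The cap at 1 makes the squared norm no larger than the norm.
      have hc := EMetric.cauchySeq_iff.1 huv.cauchySeq (min ε 1)
        (lt_min hε one_pos)
      obtain ⟨N, hN⟩ := hc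
      refine ⟨N, fun i hi j hj => ?_⟩
      have h1 := hN i hi j hj
      rw [edist_eq_enorm_sub] at h1
      rw [hsub, pow_two]
      exact (mul_le_of_le_one_right zero_le (h1.trans_le (min_le_right _ _)).le).trans_lt
        (h1.trans_le (min_le_left _ _)))
  obtain ⟨ns, hns, hae⟩ := (tendstoInMeasure_of_tendsto_Lp huv).exists_seq_tendsto_ae
  refine ⟨g, hg, ?_⟩
  filter_upwards [hae, ae_mem_of_weightedMeasure hD, ae_all_iff.2 hfu] with z hz hzD hzf
  refine tendsto_nhds_unique hz ?_
  simp only [hzf]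
  exact (hlim z hzD).comp hns.tendsto_atTop

theorem eqOn_of_weightedNormSq_eq_zero (hD : IsOpen D) (hψ : IsPSH ψ D) {f : (Fin n → ℂ) → ℂ}
    (hf : AnalyticOnNhd ℂ f D) (h0 : weightedNormSq D ψ f = 0) : EqOn f 0 D := by
  intro z hz
  obtain ⟨r, hr, C, hC, -, hb⟩ := exists_local_bound hD hψ hz
  have h1 := hb f hf z (Metric.mem_ball_self hr)
  rw [h0, mul_zero] at h1
  simpa using h1

theorem eqOn_of_ae_eq (hD : IsOpen D) (hψ : IsPSH ψ D) {f g : (Fin n → ℂ) → ℂ}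
    (hf : AnalyticOnNhd ℂ f D) (hg : AnalyticOnNhd ℂ g D) (h : f =ᵐ[weightedMeasure D ψ] g) :
    EqOn f g D := by
  have h1 : weightedNormSq D ψ (f - g) = 0 := by
    rw [← eLpNorm_sq_eq_weightedNormSq hD hψ (hf.sub hg), eLpNorm_congr_ae (g := 0),
      eLpNorm_zero, zero_pow two_ne_zero]
    filter_upwards [h] with z hz
    simp [hz]
  intro z hz
  exact sub_eq_zero.1 (eqOn_of_weightedNormSq_eq_zero hD hψ (hf.sub hg) h1 hz)

/-- The holomorphic representative of an element of the weighted Bergman space. -/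
noncomputable def bergmanRep (u : bergmanSubmodule D ψ) : (Fin n → ℂ) → ℂ := u.2.choose

theorem bergmanRep_analytic (u : bergmanSubmodule D ψ) : AnalyticOnNhd ℂ (bergmanRep u) D :=
  u.2.choose_spec.1

theorem bergmanRep_ae_eq (u : bergmanSubmodule D ψ) :
    (u : Lp ℂ 2 (weightedMeasure D ψ)) =ᵐ[weightedMeasure D ψ] bergmanRep u :=
  u.2.choose_spec.2

theorem weightedNormSq_bergmanRep (hD : IsOpen D) (hψ : IsPSH ψ D) (u : bergmanSubmodule D ψ) :
    weightedNormSq D ψ (bergmanRep u) = ‖u‖ₑ ^ 2 :=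
  (enorm_sq_eq_weightedNormSq hD hψ (bergmanRep_analytic u) (bergmanRep_ae_eq u)).symm

theorem taylorCoeff_bergmanRep (hD : IsOpen D) (h0 : (0 : Fin n → ℂ) ∈ D) (hψ : IsPSH ψ D)
    {u : bergmanSubmodule D ψ} {f : (Fin n → ℂ) → ℂ} (hf : AnalyticOnNhd ℂ f D)
    (h : (u : Lp ℂ 2 (weightedMeasure D ψ)) =ᵐ[weightedMeasure D ψ] f) :
    taylorCoeff (bergmanRep u) = taylorCoeff f :=
  taylorCoeff_congr (Filter.eventuallyEq_of_mem (hD.mem_nhds h0)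
    (eqOn_of_ae_eq hD hψ (bergmanRep_analytic u) hf ((bergmanRep_ae_eq u).symm.trans h)))

theorem exists_bergmanRep_of_mem (hD : IsOpen D) (hψ : IsPSH ψ D) {f : (Fin n → ℂ) → ℂ}
    (hf : f ∈ weightedBergman D ψ) : ∃ u : bergmanSubmodule D ψ,
      (u : Lp ℂ 2 (weightedMeasure D ψ)) =ᵐ[weightedMeasure D ψ] f := by
  have hmem : MemLp f 2 (weightedMeasure D ψ) := by
    refine ⟨hf.1.aestronglyMeasurable_weighted hD, ?_⟩
    have h1 := hf.2
    rw [← eLpNorm_sq_eq_weightedNormSq hD hψ hf.1] at h1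
    by_contra hc
    rw [not_lt, top_le_iff] at hc
    simp [hc] at h1
  exact ⟨⟨hmem.toLp f, f, hf.1, hmem.coeFn_toLp⟩, hmem.coeFn_toLp⟩

/-- The weighted norm controls the sup norm near the origin, and Cauchy estimates then control
derivatives. -/
theorem exists_taylorCoeff_bound (hD : IsOpen D) (h0 : (0 : Fin n → ℂ) ∈ D) (hψ : IsPSH ψ D)
    (α : Fin n → ℕ) : ∃ K : ℝ, ∀ u : bergmanSubmodule D ψ,
      ‖taylorCoeff (bergmanRep u) α‖ ≤ K * ‖u‖ := by
  obtain ⟨r, hr, C, hC, hsub, hb⟩ := exists_local_bound hD hψ h0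
  set k := ∑ i, α i with hk
  set δ := r / (k + 1) with hδ
  have hδ0 : 0 < δ := by positivity
  have hkδ : k * δ < r := by
    rw [hδ, mul_div_assoc', div_lt_iff₀ (by positivity)]
    nlinarith
  set A : ℝ := ((∏ i, (α i).factorial : ℕ) : ℝ)
  refine ⟨Real.sqrt C.toReal * (2 / δ) ^ k / A, fun u => ?_⟩
  have hbound : ∀ w ∈ Metric.ball (0 : Fin n → ℂ) r,
      ‖bergmanRep u w‖ ≤ Real.sqrt C.toReal * ‖u‖ := by
    intro w hw
    have h1 := hb _ (bergmanRep_analytic u) w hw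
    rw [weightedNormSq_bergmanRep hD hψ] at h1
    have h2 := ENNReal.toReal_mono (ENNReal.mul_ne_top hC (ENNReal.pow_ne_top enorm_ne_top)) h1
    rw [ENNReal.toReal_mul, ENNReal.toReal_pow, ENNReal.toReal_pow, toReal_enorm, toReal_enorm]
      at h2
    refine (pow_le_pow_iff_left₀ (norm_nonneg _) (by positivity) two_ne_zero).1 ?_
    rwa [mul_pow, Real.sq_sqrt ENNReal.toReal_nonneg]
  have h3 := AnalyticOnNhd.norm_iteratedFDeriv_le
    (fun w hw => bergmanRep_analytic u w (hsub hw)) hbound hδ0 hkδ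
  rw [taylorCoeff, norm_div, Complex.norm_natCast, div_mul_eq_mul_div]
  refine div_le_div_of_nonneg_right ?_ (by positivity)
  refine (ContinuousMultilinearMap.le_opNorm _ _).trans ?_
  rw [Finset.prod_eq_one, mul_one]
  · exact h3.trans_eq (by ring)
  · intro j _
    rw [Pi.norm_single, norm_one]

theorem taylorCoeff_bergmanRep_add (hD : IsOpen D) (h0 : (0 : Fin n → ℂ) ∈ D) (hψ : IsPSH ψ D)
    (u v : bergmanSubmodule D ψ) : taylorCoeff (bergmanRep (u + v)) =
      taylorCoeff (bergmanRep u) + taylorCoeff (bergmanRep v) := by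
  have hu := bergmanRep_analytic u
  have hv := bergmanRep_analytic v
  have h1 : ((u + v : bergmanSubmodule D ψ) : Lp ℂ 2 (weightedMeasure D ψ))
      =ᵐ[weightedMeasure D ψ] bergmanRep u + bergmanRep v := by
    rw [Submodule.coe_add]
    exact (Lp.coeFn_add _ _).trans ((bergmanRep_ae_eq u).add (bergmanRep_ae_eq v))
  rw [taylorCoeff_bergmanRep hD h0 hψ (hu.add hv) h1, taylorCoeff_add (hu 0 h0) (hv 0 h0)]

theorem taylorCoeff_bergmanRep_smul (hD : IsOpen D) (h0 : (0 : Fin n → ℂ) ∈ D) (hψ : IsPSH ψ D)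
    (c : ℂ) (u : bergmanSubmodule D ψ) : taylorCoeff (bergmanRep (c • u)) =
      c • taylorCoeff (bergmanRep u) := by
  have hu := bergmanRep_analytic u
  have h1 : ((c • u : bergmanSubmodule D ψ) : Lp ℂ 2 (weightedMeasure D ψ))
      =ᵐ[weightedMeasure D ψ] c • bergmanRep u := by
    rw [Submodule.coe_smul]
    exact (Lp.coeFn_smul _ _).trans ((bergmanRep_ae_eq u).const_smul c)
  rw [taylorCoeff_bergmanRep hD h0 hψ hu.const_smul h1, taylorCoeff_smul (hu 0 h0)]

/-- The Taylor coefficients at the origin as continuous functionals on the Bergman space. -/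
theorem exists_taylorCoeff_functional (hD : IsOpen D) (h0 : (0 : Fin n → ℂ) ∈ D)
    (hψ : IsPSH ψ D) (α : Fin n → ℕ) : ∃ L : StrongDual ℂ (bergmanSubmodule D ψ),
      ∀ u, L u = taylorCoeff (bergmanRep u) α :=
  ⟨LinearMap.mkContinuousOfExistsBound
    { toFun := fun u => taylorCoeff (bergmanRep u) α
      map_add' := fun u v => congrFun (taylorCoeff_bergmanRep_add hD h0 hψ u v) α
      map_smul' := fun c u => congrFun (taylorCoeff_bergmanRep_smul hD h0 hψ c u) α }
    (exists_taylorCoeff_bound hD h0 hψ α), fun _ => rfl⟩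

end BergmanSpace

/-! ### Pairings and the upper bound for `B` -/

theorem summable_germPairing {n : ℕ} {ξ : (Fin n → ℕ) → ℂ} (hξ : ξ ∈ ell1 n) (F : HolGerm n) :
    Summable fun α => ξ α * germCoeff F α := by
  obtain ⟨f, hf, rfl⟩ := HolGerm.exists_eq_mk F
  exact summable_pairing hξ hf

theorem germPairing_sub {n : ℕ} {ξ : (Fin n → ℕ) → ℂ} (hξ : ξ ∈ ell1 n) (F G : HolGerm n) :
    germPairing ξ (F - G) = germPairing ξ F - germPairing ξ G := by
  simp only [germPairing_eq_tsum]
  rw [← (summable_germPairing hξ F).tsum_sub (summable_germPairing hξ G)]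
  exact tsum_congr fun α => by rw [germCoeff_sub, Pi.sub_apply, mul_sub]

theorem pairing_smul {n : ℕ} (ξ : (Fin n → ℕ) → ℂ) {f : (Fin n → ℂ) → ℂ}
    (hf : AnalyticAt ℂ f 0) (c : ℂ) : pairing ξ (c • f) 0 = c * pairing ξ f 0 := by
  rw [pairing_eq_tsum, pairing_eq_tsum, taylorCoeff_smul hf, ← tsum_mul_left]
  exact tsum_congr fun α => mul_left_comm _ _ _

theorem weightedNormSq_smul {n : ℕ} (D : Set (Fin n → ℂ)) (ψ : (Fin n → ℂ) → EReal)
    (f : (Fin n → ℂ) → ℂ) (c : ℂ) :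
    weightedNormSq D ψ (c • f) = ‖c‖ₑ ^ 2 * weightedNormSq D ψ f := by
  unfold weightedNormSq
  rw [← lintegral_const_mul' _ _ (ENNReal.pow_ne_top enorm_ne_top)]
  refine lintegral_congr fun z => ?_
  rw [Pi.smul_apply, enorm_smul, mul_pow, mul_assoc]

/-- Rescale `f` to norm one. If its norm is zero, `f` vanishes on `D` and both sides are zero, even
for an infinite kernel. -/
theorem enorm_pairing_sq_le {n : ℕ} {D : Set (Fin n → ℂ)} (hD : IsOpen D)
    (h0 : (0 : Fin n → ℂ) ∈ D) {ψ : (Fin n → ℂ) → EReal} (hψ : IsPSH ψ D)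
    (ξ : (Fin n → ℕ) → ℂ) {f : (Fin n → ℂ) → ℂ} (hf : f ∈ weightedBergman D ψ) :
    ‖pairing ξ f 0‖ₑ ^ 2 ≤ weightedNormSq D ψ f * weightedKernel ξ D ψ 0 := by
  rcases eq_or_ne (weightedNormSq D ψ f) 0 with hN | hN
  · have h1 : f =ᶠ[𝓝 0] (0 : ℂ) • f := by
      filter_upwards [hD.mem_nhds h0] with z hz
      rw [Pi.smul_apply, zero_smul]
      exact eqOn_of_weightedNormSq_eq_zero hD hψ hf.1 hN hz
    rw [pairing_congr ξ h1, pairing_smul ξ (hf.1 0 h0)]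
    simp
  · have hNt : weightedNormSq D ψ f ≠ ⊤ := hf.2.ne
    set N := weightedNormSq D ψ f with hNdef
    have hNr : 0 < N.toReal := ENNReal.toReal_pos hN hNt
    set c : ℂ := (((Real.sqrt N.toReal)⁻¹ : ℝ) : ℂ) with hc
    have hcN : ‖c‖ₑ ^ 2 = N⁻¹ := by
      rw [← ofReal_norm, ← ENNReal.ofReal_pow (norm_nonneg _), hc, Complex.norm_real,
        Real.norm_of_nonneg (by positivity), inv_pow, Real.sq_sqrt hNr.le,
        ENNReal.ofReal_inv_of_pos hNr, ENNReal.ofReal_toReal hNt]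
    have hcf : weightedNormSq D ψ (c • f) = 1 := by
      rw [weightedNormSq_smul, hcN, ENNReal.inv_mul_cancel hN hNt]
    have hle : ‖pairing ξ (c • f) 0‖ₑ ^ 2 ≤ weightedKernel ξ D ψ 0 :=
      le_iSup₂ (f := fun g (_ : g ∈ {g | g ∈ weightedBergman D ψ ∧ weightedNormSq D ψ g ≤ 1}) =>
        ‖pairing ξ g 0‖ₑ ^ 2) (c • f)
        ⟨⟨hf.1.const_smul, hcf.trans_lt ENNReal.one_lt_top⟩, hcf.le⟩
    rw [pairing_smul ξ (hf.1 0 h0), enorm_mul, mul_pow, hcN] at hle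
    exact (ENNReal.inv_mul_le_iff hN hNt).1 hle

/-- Annihilating `I` makes `ξ` take the same value on `F` and on every competitor, so the preceding
estimate bounds each quotient. -/
theorem Bweighted_le_minimalIntegral {n : ℕ} {D : Set (Fin n → ℂ)} (hD : IsOpen D)
    (h0 : (0 : Fin n → ℂ) ∈ D) {ψ : (Fin n → ℂ) → EReal} (hψ : IsPSH ψ D)
    (I : Ideal (HolGerm n)) (F : HolGerm n) :
    Bweighted ψ F I D ≤ minimalIntegral F ψ I D := by
  refine iSup₂_le fun ξ hξ => le_iInf₂ fun f hf => ?_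
  obtain ⟨hfA, G, hfG, hGF⟩ := hf
  refine ENNReal.div_le_of_le_mul ?_
  have h1 : germPairing ξ G - germPairing ξ F = 0 := by
    rw [← germPairing_sub hξ.1]
    exact hξ.2.1 _ hGF
  have h2 : germPairing ξ G = pairing ξ f 0 := by
    unfold germPairing
    rw [← hfG]
    rfl
  rw [← sub_eq_zero.1 h1, h2]
  exact enorm_pairing_sq_le hD h0 hψ ξ hfA

theorem BweightedCirc_le_Bweighted {n : ℕ} (D : Set (Fin n → ℂ)) (ψ : (Fin n → ℂ) → EReal)
    (I : Ideal (HolGerm n)) (F : HolGerm n) : BweightedCirc ψ F I D ≤ Bweighted ψ F I D :=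
  biSup_mono fun _ hξ => hξ.1

/-! ### Finitely supported annihilators and the lower bound for `B°` -/

/-- The pairing of a finitely supported family with a germ, as a linear form. -/
noncomputable def finPairing {n : ℕ} (a : (Fin n → ℕ) → ℂ) : ((Fin n → ℕ) →₀ ℂ) →ₗ[ℂ] ℂ :=
  Finsupp.linearCombination ℂ a

theorem tsum_eq_finPairing {n : ℕ} (ξ : (Fin n → ℕ) →₀ ℂ) (a : (Fin n → ℕ) → ℂ) :
    ∑' α, ξ α * a α = finPairing a ξ := by
  rw [finPairing, Finsupp.linearCombination_apply, Finsupp.sum]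
  refine tsum_eq_sum fun α hα => ?_
  rw [Finsupp.notMem_support_iff.1 hα, zero_mul]

/-- The finitely supported families annihilating an ideal. -/
noncomputable def finAnnihilator {n : ℕ} (I : Ideal (HolGerm n)) :
    Submodule ℂ ((Fin n → ℕ) →₀ ℂ) :=
  ⨅ G : I, LinearMap.ker (finPairing (germCoeff (G : HolGerm n)))

theorem mem_finAnnihilator {n : ℕ} {I : Ideal (HolGerm n)} {ξ : (Fin n → ℕ) →₀ ℂ} :
    ξ ∈ finAnnihilator I ↔ ∀ G ∈ I, finPairing (germCoeff G) ξ = 0 := by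
  simp [finAnnihilator]

theorem mem_ellIdeal_inter_ell0 {n : ℕ} {I : Ideal (HolGerm n)} {ξ : (Fin n → ℕ) →₀ ℂ}
    (hξ : ξ ∈ finAnnihilator I) (hne : ξ ≠ 0) : (ξ : (Fin n → ℕ) → ℂ) ∈ ellIdeal I ∩ ell0 n := by
  refine ⟨⟨fun ρ _ => ?_, fun G hG => ?_, fun h => hne (DFunLike.coe_injective h)⟩, ?_⟩
  · refine summable_of_ne_finset_zero (s := ξ.support) fun α hα => ?_
    rw [Finsupp.notMem_support_iff.1 hα, norm_zero, zero_mul]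
  · rw [germPairing_eq_tsum, tsum_eq_finPairing]
    exact mem_finAnnihilator.1 hξ G hG
  · refine ⟨ξ.support.sup fun α => ∑ i, α i, fun α hα => ?_⟩
    by_contra hc
    exact absurd (Finset.le_sup (f := fun α : Fin n → ℕ => ∑ i, α i)
      (Finsupp.mem_support_iff.2 hc)) (not_le.2 hα)

/-- A germ annihilated by every finitely supported family that annihilates an ideal belongs to
the ideal. -/
theorem mem_ideal_of_finAnnihilator {n : ℕ} (I : Ideal (HolGerm n)) (F : HolGerm n)
    (h : ∀ ξ ∈ finAnnihilator I, finPairing (germCoeff F) ξ = 0) : F ∈ I := by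
  classical
  refine mem_ideal_of_forall_taylor I F fun k => ?_
  set S : Finset (Fin n → ℕ) := (Finset.range k).biUnion (Finset.piAntidiag Finset.univ) with hS
  have hmemS : ∀ α : Fin n → ℕ, ∑ i, α i < k → α ∈ S := fun α hα => by simp [hS, hα]
  let W : Submodule ℂ (S → ℂ) :=
    { carrier := {x | ∃ H ∈ I, x = fun α : S => germCoeff H α}
      add_mem' := by
        rintro _ _ ⟨H, hH, rfl⟩ ⟨K, hK, rfl⟩
        exact ⟨H + K, I.add_mem hH hK, funext fun α => by rw [germCoeff_add]; rfl⟩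
      zero_mem' := ⟨0, I.zero_mem, funext fun α => by
        rw [show germCoeff (0 : HolGerm n) = 0 by simpa using germCoeff_sub (0 : HolGerm n) 0]
        rfl⟩
      smul_mem' := by
        rintro c _ ⟨H, hH, rfl⟩
        exact ⟨HolGerm.const n c * H, I.mul_mem_left _ hH, funext fun α => by
          rw [germCoeff_const_mul]; rfl⟩ }
  suffices hW : (fun α : S => germCoeff F α) ∈ W by
    obtain ⟨H, hH, hFH⟩ := hW
    exact ⟨H, hH, fun α hα => (congrFun hFH ⟨α, hmemS α hα⟩).symm⟩
  by_contra hnot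
  -- The jets of `I` form a subspace of a finite-dimensional space. A functional separating a jet
  -- from it is itself a finitely supported family annihilating `I`.
  obtain ⟨l, hl, hWl⟩ := Submodule.exists_le_ker_of_notMem hnot
  set ξ : (Fin n → ℕ) →₀ ℂ := ∑ α : S, Finsupp.single (α : Fin n → ℕ) (l (Pi.single α 1))
  have hpair : ∀ G : HolGerm n, finPairing (germCoeff G) ξ = l fun α : S => germCoeff G α := by
    intro G
    have h1 : (fun α : S => germCoeff G α)
        = ∑ α : S, germCoeff G α • (Pi.single α 1 : S → ℂ) := by
      funext β
      simp [Finset.sum_apply, Pi.single_apply]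
    rw [h1, map_sum, map_sum]
    refine Finset.sum_congr rfl fun α _ => ?_
    rw [map_smul, finPairing, Finsupp.linearCombination_single, smul_eq_mul, smul_eq_mul, mul_comm]
  refine hl ?_
  rw [← hpair]
  refine h ξ (mem_finAnnihilator.2 fun G hG => ?_)
  rw [hpair]
  exact hWl ⟨G, hG, rfl⟩

/-- The inequality `C ≤ B°`, for any realization of the weighted Bergman space as a Hilbert
space on which the Taylor coefficients at the origin are continuous. -/
theorem minimalIntegral_le_BweightedCirc_of_hilbert {n : ℕ} {D : Set (Fin n → ℂ)}
    (h0 : (0 : Fin n → ℂ) ∈ D) {ψ : (Fin n → ℂ) → EReal} (I : Ideal (HolGerm n)) (F : HolGerm n)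
    {E : Type*} [NormedAddCommGroup E] [InnerProductSpace ℂ E] [CompleteSpace E]
    (rep : E → (Fin n → ℂ) → ℂ) (hrep : ∀ u, AnalyticOnNhd ℂ (rep u) D)
    (hnorm : ∀ u, weightedNormSq D ψ (rep u) = ‖u‖ₑ ^ 2)
    (hsurj : ∀ f ∈ weightedBergman D ψ, ∃ u : E, taylorCoeff (rep u) = taylorCoeff f ∧
      ‖u‖ₑ ^ 2 = weightedNormSq D ψ f)
    (L : (Fin n → ℕ) → StrongDual ℂ E) (hL : ∀ α u, L α u = taylorCoeff (rep u) α) :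
    minimalIntegral F ψ I D ≤ BweightedCirc ψ F I D := by
  rcases eq_or_ne (BweightedCirc ψ F I D) ⊤ with hb | hb
  · rw [hb]
    exact le_top
  generalize hbdef : BweightedCirc ψ F I D = b at hb ⊢
  obtain ⟨B, hBapp⟩ : ∃ B : finAnnihilator I →ₗ[ℂ] StrongDual ℂ E,
      ∀ ξ u, B ξ u = finPairing (taylorCoeff (rep u)) (ξ : (Fin n → ℕ) →₀ ℂ) := by
    refine ⟨(Finsupp.linearCombination ℂ L).comp (finAnnihilator I).subtype, fun ξ u => ?_⟩
    rw [finPairing, LinearMap.comp_apply, Submodule.subtype_apply,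
      Finsupp.linearCombination_apply, Finsupp.linearCombination_apply, Finsupp.sum, Finsupp.sum,
      sum_apply]
    exact Finset.sum_congr rfl fun α _ => by rw [smul_apply, hL]
  obtain ⟨φ, hφ⟩ : ∃ φ : finAnnihilator I →ₗ[ℂ] ℂ,
      ∀ ξ, φ ξ = finPairing (germCoeff F) (ξ : (Fin n → ℕ) →₀ ℂ) :=
    ⟨(finPairing (germCoeff F)).comp (finAnnihilator I).subtype, fun _ => rfl⟩
  have hkernel : ∀ (ξ : finAnnihilator I) (K : ℝ), 0 ≤ K → (∀ u, ‖B ξ u‖ ≤ K * ‖u‖) →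
      weightedKernel (ξ : (Fin n → ℕ) →₀ ℂ) D ψ 0 ≤ ENNReal.ofReal K ^ 2 := by
    intro ξ K hK hBK
    refine iSup₂_le fun f hf => ?_
    obtain ⟨u, hu, hun⟩ := hsurj f hf.1
    have h1 : pairing (ξ : (Fin n → ℕ) →₀ ℂ) f 0 = B ξ u := by
      rw [hBapp, pairing_eq_tsum, tsum_eq_finPairing, hu]
    have h2 : ‖u‖ₑ ^ 2 ≤ 1 := hun.trans_le hf.2
    rw [h1]
    have h3 : ‖B ξ u‖ₑ ≤ ENNReal.ofReal K * ‖u‖ₑ := by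
      rw [← ofReal_norm, ← ofReal_norm, ← ENNReal.ofReal_mul hK]
      exact ENNReal.ofReal_le_ofReal (hBK u)
    calc ‖B ξ u‖ₑ ^ 2 ≤ (ENNReal.ofReal K * ‖u‖ₑ) ^ 2 := pow_le_pow_left' h3 2
      _ = ENNReal.ofReal K ^ 2 * ‖u‖ₑ ^ 2 := mul_pow _ _ _
      _ ≤ ENNReal.ofReal K ^ 2 := mul_le_of_le_one_right zero_le h2
  have hbound : ∀ (ξ : finAnnihilator I) (K : ℝ), 0 ≤ K → (∀ u, ‖B ξ u‖ ≤ K * ‖u‖) →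
      ‖φ ξ‖ ≤ Real.sqrt b.toReal * K := by
    intro ξ K hK hBK
    rcases eq_or_ne ξ 0 with rfl | hξ
    · rw [map_zero, norm_zero]
      positivity
    have hmem := mem_ellIdeal_inter_ell0 ξ.2 (fun h => hξ (Subtype.ext h))
    have h1 : ‖germPairing (ξ : (Fin n → ℕ) →₀ ℂ) F‖ₑ ^ 2 /
        weightedKernel (ξ : (Fin n → ℕ) →₀ ℂ) D ψ 0 ≤ b := hbdef ▸
      le_iSup₂ (f := fun (ξ : (Fin n → ℕ) → ℂ) (_ : ξ ∈ ellIdeal I ∩ ell0 n) =>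
        ‖germPairing ξ F‖ₑ ^ 2 / weightedKernel ξ D ψ 0) _ hmem
    have hKt : weightedKernel (ξ : (Fin n → ℕ) →₀ ℂ) D ψ 0 ≠ ⊤ :=
      ((hkernel ξ K hK hBK).trans_lt (ENNReal.pow_ne_top ENNReal.ofReal_ne_top).lt_top).ne
    -- With `b` finite, a zero kernel forces a zero numerator, so the quotient bound becomes a
    -- product bound in all cases.
    rw [ENNReal.div_le_iff_le_mul (Or.inr hb) (Or.inl hKt), germPairing_eq_tsum,
      tsum_eq_finPairing, ← hφ] at h1
    have h2 : ‖φ ξ‖ₑ ^ 2 ≤ b * ENNReal.ofReal K ^ 2 :=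
      h1.trans (mul_le_mul_right (hkernel ξ K hK hBK) b)
    have h3 := ENNReal.toReal_mono
      (ENNReal.mul_ne_top hb (ENNReal.pow_ne_top ENNReal.ofReal_ne_top)) h2
    rw [ENNReal.toReal_mul, ENNReal.toReal_pow, ENNReal.toReal_pow, toReal_enorm,
      ENNReal.toReal_ofReal hK] at h3
    refine (pow_le_pow_iff_left₀ (norm_nonneg _) (by positivity) two_ne_zero).1 ?_
    rwa [mul_pow, Real.sq_sqrt ENNReal.toReal_nonneg]
  obtain ⟨u, hu, huφ⟩ := exists_norm_le_of_functional_bound (E := E)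
    (V := finAnnihilator I) B φ (Real.sqrt_nonneg b.toReal) hbound
  have hf := hrep u
  have hle : weightedNormSq D ψ (rep u) ≤ b := by
    rw [hnorm, ← ENNReal.toReal_le_toReal
      (ENNReal.pow_ne_top enorm_ne_top) hb, ENNReal.toReal_pow, toReal_enorm]
    exact (Real.le_sqrt (norm_nonneg _) ENNReal.toReal_nonneg).1 hu
  refine le_trans (iInf₂_le (rep u) ⟨⟨hf, hle.trans_lt hb.lt_top⟩,
    HolGerm.mk _ (hf 0 h0), rfl, ?_⟩) hle
  -- The representing vector has the same pairings as `F` with all finite annihilators, which is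
  -- enough for congruence modulo `I`.
  refine mem_ideal_of_finAnnihilator I _ fun ξ hξ => ?_
  have h1 := huφ ⟨ξ, hξ⟩
  rw [hBapp, hφ] at h1
  have h2 : ∀ a c : (Fin n → ℕ) → ℂ,
      finPairing (a - c) ξ = finPairing a ξ - finPairing c ξ := by
    intro a c
    simp only [finPairing, Finsupp.linearCombination_apply, Finsupp.sum, Pi.sub_apply, smul_sub,
      Finset.sum_sub_distrib]
  rw [germCoeff_sub, h2, germCoeff_mk]
  exact sub_eq_zero.2 h1

theorem minimalIntegral_le_BweightedCirc {n : ℕ} {D : Set (Fin n → ℂ)} (hD : IsOpen D)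
    (h0 : (0 : Fin n → ℂ) ∈ D) {ψ : (Fin n → ℂ) → EReal} (hψ : IsPSH ψ D)
    (I : Ideal (HolGerm n)) (F : HolGerm n) :
    minimalIntegral F ψ I D ≤ BweightedCirc ψ F I D := by
  have hcomplete : CompleteSpace (bergmanSubmodule D ψ) :=
    (isClosed_bergmanSubmodule hD hψ).completeSpace_coe
  choose L hL using exists_taylorCoeff_functional hD h0 hψ
  refine minimalIntegral_le_BweightedCirc_of_hilbert h0 I F bergmanRep bergmanRep_analytic
    (weightedNormSq_bergmanRep hD hψ) (fun f hf => ?_) L hL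
  obtain ⟨u, hu⟩ := exists_bergmanRep_of_mem hD hψ hf
  exact ⟨u, taylorCoeff_bergmanRep hD h0 hψ hf.1 hu, enorm_sq_eq_weightedNormSq hD hψ hf.1 hu⟩

theorem mainTheorem5 (n : ℕ) (D : Set (Fin n → ℂ)) (hD : IsOpen D) (hDc : IsConnected D)
    (h0 : (0 : Fin n → ℂ) ∈ D) (ψ : (Fin n → ℂ) → EReal) (hψ : IsPSH ψ D)
    (I : Ideal (HolGerm n)) (hI : I ≠ ⊤) (hIψ : ¬ multiplierIdeal ψ ⊆ (I : Set (HolGerm n)))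
    (F : HolGerm n) :
    BweightedCirc ψ F I D = Bweighted ψ F I D ∧
      Bweighted ψ F I D = minimalIntegral F ψ I D := by
  have h1 := BweightedCirc_le_Bweighted D ψ I F
  have h2 := Bweighted_le_minimalIntegral hD h0 hψ I F
  have h3 := minimalIntegral_le_BweightedCirc hD h0 hψ I F
  exact ⟨le_antisymm h1 (h2.trans h3), le_antisymm h2 (h3.trans h1)⟩
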